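/- Let $P\subset\mathbb R^n$ be a compact convex polytope. Let $\psi_0,\dot\psi_0\in C^\infty(\mathbb R^n)$ with $\nabla^2\psi_0>0$ everywhere, $\overline{\operatorname{Im}\nabla\psi_0}=P$ and $\dot\psi_0$ bounded. For $0<T<\infty$, an *admissible solution* on $[0,T]\times\mathbb R^n$ of the Cauchy problem for the homogeneous real Monge–Ampère equation (HRMA) $$\mathrm{MA}\,\psi=0\ \text{ on } [0,T]\times\mathbb R^n,\qquad \psi(0,\cdot)=\psi_0,\quad \partial_s\psi(0,\cdot)=\dot\psi_0$$ is a convex function $\psi$ on $[0,T]\times\mathbb R^n$ that satisfies the two initial conditions; such that for every $s\in[0,T]$ the function $\psi(s,\cdot)$ is strictly convex on $\mathbb R^n$ and the closure of the image of its subdifferential is $P$; and which is an Alexandrov weak solution: $\bigcup_{(s,x)\in(0,T)\times\mathbb R^n}\partial\psi(s,x)\subset\mathbb R^{n+1}$ has Lebesgue measure zero, where $\partial\psi$ is the space-time subdifferential. It is an *admissible $C^1$ weak solution* if moreover $\psi\in C^1([0,T]\times\mathbb R^n)$. Let $T^1_{\rm span}\in[0,\infty]$ be the supremum of the $T>0$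 for which an admissible $C^1$ weak solution on $[0,T]\times\mathbb R^n$ exists. Let $$T^{\rm cvx}_{\rm span}:=\sup\{s>0:\ \psi_0^\star-s\,\dot\psi_0\circ(\nabla\psi_0)^{-1}\text{ is convex on } \operatorname{Im}\nabla\psi_0\}\in[0,\infty],$$ where $\psi_0^\star$ is the Legendre transform of $\psi_0$; in both cases $\sup\emptyset=0$. Then: 1. Every admissible $C^1$ weak solution on $[0,T]\times\mathbb R^n$ is $C^\infty$ on $[0,T)\times\mathbb R^n$, and it is $C^\infty$ on all of $[0,T]\times\mathbb R^n$ if $T<T^{\rm cvx}_{\rm span}$. 2. $T^1_{\rm span}=T^{\rm cvx}_{\rm span}$. 3. If $T>T^{\rm cvx}_{\rm span}$, there is no admissible $C^1$ weak solution on $[0,T]\times\mathbb R^n$. -/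

import Mathlib

open Set MeasureTheory
open scoped ENNReal ContDiff Gradient

/-- The space `ℝⁿ` with its Euclidean structure. -/
abbrev RSpace (n : ℕ) : Type := EuclideanSpace ℝ (Fin n)

/-- The closed space-time slab `[0, T] × ℝⁿ`. -/
def slab (n : ℕ) (T : ℝ) : Set (ℝ × RSpace n) := Icc 0 T ×ˢ univ

/-- The subdifferential `∂f(x) ⊆ ℝⁿ` of a function `f : ℝⁿ → ℝ` at `x`. -/
def subdifferential {n : ℕ} (f : RSpace n → ℝ) (x : RSpace n) : Set (RSpace n) :=
  {ξ | ∀ x' : RSpace n, f x + inner ℝ ξ (x' - x) ≤ f x'}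

/-- The subdifferential `∂ρ(z) ⊆ ℝ × ℝⁿ = ℝⁿ⁺¹`, at a space-time point `z = (s, x)`, of a function
`ρ` on the slab `[0, T] × ℝⁿ`. Values of `ρ` off the slab are not used. -/
def slabSubdifferential {n : ℕ} (T : ℝ) (ρ : ℝ × RSpace n → ℝ) (z : ℝ × RSpace n) :
    Set (ℝ × RSpace n) :=
  {p | ∀ w ∈ slab n T, ρ z + (p.1 * (w.1 - z.1) + inner ℝ p.2 (w.2 - z.2)) ≤ ρ w}

/-- `ρ` is an Alexandrov weak solution of the homogeneous real Monge--Ampère equation `MA ρ = 0` on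
`[0, T] × ℝⁿ`: it is convex, and the image of its subdifferential mapping has Lebesgue measure
zero. The image is taken over the points with `0 < s < T`: at a boundary point of the slab the
subdifferential relative to the slab always contains a half-line in the time direction. -/
structure IsAlexandrovSolution {n : ℕ} (T : ℝ) (ρ : ℝ × RSpace n → ℝ) : Prop where
  convexOn : ConvexOn ℝ (slab n T) ρ
  volume_image : volume (⋃ z ∈ Ioo 0 T ×ˢ (univ : Set (RSpace n)), slabSubdifferential T ρ z) = 0

/-- `η` is an admissible subsolution on `[0, T] × ℝⁿ` of the Cauchy problem with Cauchy data
`(ψ₀, ψ₁)` (`ψ₁` is the initial velocity) and polytope `P`. -/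
structure IsAdmissibleSubsolution {n : ℕ} (ψ₀ ψ₁ : RSpace n → ℝ) (P : Set (RSpace n)) (T : ℝ)
    (η : ℝ × RSpace n → ℝ) : Prop where
  convexOn : ConvexOn ℝ (slab n T) η
  initial_value : ∀ x, η (0, x) = ψ₀ x
  initial_velocity : ∀ x, HasDerivWithinAt (fun s => η (s, x)) (ψ₁ x) (Icc 0 T) 0
  strictConvexOn : ∀ s ∈ Icc 0 T, StrictConvexOn ℝ univ (fun x => η (s, x))
  closure_image : ∀ s ∈ Icc 0 T, closure (⋃ x, subdifferential (fun x' => η (s, x')) x) = P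

/-- `η` is an admissible solution: an admissible subsolution that solves the homogeneous real
Monge--Ampère equation in the sense of Alexandrov. -/
structure IsAdmissibleSolution {n : ℕ} (ψ₀ ψ₁ : RSpace n → ℝ) (P : Set (RSpace n)) (T : ℝ)
    (η : ℝ × RSpace n → ℝ) : Prop extends IsAdmissibleSubsolution ψ₀ ψ₁ P T η where
  alexandrov : IsAlexandrovSolution T η

/-- `η` is an admissible `C¹` weak solution on `[0, T] × ℝⁿ` (`C¹` up to the boundary). -/
def IsAdmissibleC1Solution {n : ℕ} (ψ₀ ψ₁ : RSpace n → ℝ) (P : Set (RSpace n)) (T : ℝ)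
    (η : ℝ × RSpace n → ℝ) : Prop :=
  IsAdmissibleSolution ψ₀ ψ₁ P T η ∧ ContDiffOn ℝ 1 η (slab n T)

/-- The `C¹` lifespan: the supremum, in `[0, ∞]`, of the times `T > 0` for which the Cauchy problem
has an admissible `C¹` weak solution on `[0, T] × ℝⁿ` (it is `0` if there is no such time). -/
noncomputable def c1Lifespan {n : ℕ} (ψ₀ ψ₁ : RSpace n → ℝ) (P : Set (RSpace n)) : ℝ≥0∞ :=
  ⨆ (T : ℝ) (_ : 0 < T ∧ ∃ η, IsAdmissibleC1Solution ψ₀ ψ₁ P T η), ENNReal.ofReal T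

/-- The Legendre transform `ψ⋆(y) = sup_x (⟨x, y⟩ - ψ(x))`. It is used only at points of the range
of the gradient of a convex `ψ`, where the supremum is attained. -/
noncomputable def legendreTransform {n : ℕ} (ψ : RSpace n → ℝ) (y : RSpace n) : ℝ :=
  ⨆ x : RSpace n, (inner ℝ x y - ψ x)

/-- The convex lifespan: the supremum, in `[0, ∞]`, of the times `s > 0` for which
`ψ₀⋆ - s ψ₁ ∘ (∇ψ₀)⁻¹` is convex on `Im ∇ψ₀`, the domain of `(∇ψ₀)⁻¹` (it is `0` if there is no
such time). -/
noncomputable def cvxLifespan {n : ℕ} (ψ₀ ψ₁ : RSpace n → ℝ) : ℝ≥0∞ :=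
  ⨆ (s : ℝ) (_ : 0 < s ∧ ConvexOn ℝ (range (∇ ψ₀))
    (fun y => legendreTransform ψ₀ y - s * ψ₁ (Function.invFun (∇ ψ₀) y))), ENNReal.ofReal s

/-! The Legendre transform in the space variable alone linearises the equation. Write `u = ψ₀⋆`, `g
= (∇ψ₀)⁻¹`, `w = ψ₁ ∘ g` on `U = Im ∇ψ₀`, which is the interior of `P`.

From a solution to convexity: for fixed `y`, `H(s) = min_x (η(s, x) - ⟨y, x⟩)` is convex in `s`, and
a subgradient `p` of `H` at `s` yields a space-time subgradient `(p, y)` of `η`. By Fubini, for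
almost every `y` the subgradients of `H` form a null set. Two different subgradients would produce a
whole interval of them, so `H` is affine, and the initial velocity fixes its slope as `w y`. By
continuity `η(s, ·)⋆ = u - s w` on all of `U` (`IsAdmissibleC1Solution.legendreTransform_eq`), so `u
- T w` is convex.

From convexity to a solution: if `u - S w` is convex and `0 ≤ s < S`, then `u - s w = (1 - s/S) u +
(s/S) (u - S w)` has positive definite Hessian. Its gradient maps `U` bijectively onto `ℝⁿ`
(`image_gradient_sub_eq_univ`), with an inverse smooth in `(s, x)` (`contDiffOn_inverse`).
Conjugating back gives a smooth solution whose space-time gradients lie on the graph of `w`, a null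
set. The same inverse expresses any `C¹` solution, which gives regularity. -/

open Filter Topology

/-! ### Subgradient inequalities and differentiability. -/

section Subgradients

variable {F : Type*} [NormedAddCommGroup F] [NormedSpace ℝ F]

/-- Reduces to one variable along the segment from `x` to `y`. Only the derivative within `S` is
needed, so the bound also applies on the faces `s = 0` and `s = T` of the slab. -/
theorem ConvexOn.add_fderivWithin_le {S : Set F} {f : F → ℝ} {f' : F →L[ℝ] ℝ} {x y : F}
    (hf : ConvexOn ℝ S f) (hx : x ∈ S) (hy : y ∈ S) (h : HasFDerivWithinAt f f' S x) :
    f x + f' (y - x) ≤ f y := by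
  have hmaps : MapsTo (AffineMap.lineMap x y : ℝ → F) (Icc 0 1) S := fun t ht =>
    hf.1.lineMap_mem hx hy ht
  have hconv : ConvexOn ℝ (Icc (0 : ℝ) 1) (f ∘ (AffineMap.lineMap x y : ℝ →ᵃ[ℝ] F)) :=
    (hf.comp_affineMap (AffineMap.lineMap x y)).subset hmaps (convex_Icc 0 1)
  have hline : HasDerivWithinAt (AffineMap.lineMap x y : ℝ → F) (y - x) (Icc 0 1) 0 :=
    AffineMap.hasDerivWithinAt_lineMap
  have hd : HasDerivWithinAt (f ∘ (AffineMap.lineMap x y : ℝ →ᵃ[ℝ] F)) (f' (y - x))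
      (Icc 0 1) 0 := by
    refine HasFDerivWithinAt.comp_hasDerivWithinAt (t := S) 0 ?_ hline hmaps
    simpa using h
  have := hconv.le_slope_of_hasDerivWithinAt (by simp) (y := 1) (by simp) one_pos hd
  simp only [slope_def_field, Function.comp_apply, AffineMap.lineMap_apply_one,
    AffineMap.lineMap_apply_zero, sub_zero, div_one] at this
  linarith

theorem StrictConvexOn.add_fderivWithin_lt {S : Set F} {f : F → ℝ} {f' : F →L[ℝ] ℝ} {x y : F}
    (hf : StrictConvexOn ℝ S f) (hx : x ∈ S) (hy : y ∈ S) (hxy : x ≠ y)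
    (h : HasFDerivWithinAt f f' S x) : f x + f' (y - x) < f y := by
  have hhalf : (0 : ℝ) < 1 / 2 := by norm_num
  have hm := hf.2 hx hy hxy hhalf hhalf (by norm_num)
  have hmem := hf.1 hx hy hhalf.le hhalf.le (by norm_num)
  have h2 := hf.convexOn.add_fderivWithin_le hx hmem h
  have e : (1 / 2 : ℝ) • x + (1 / 2 : ℝ) • y - x = (1 / 2 : ℝ) • (y - x) := by module
  rw [e, map_smul] at h2
  simp only [smul_eq_mul] at hm h2
  linarith

/-- The inequalities based at `x` and at `w` squeeze the first-order remainder between `0` and `(a w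
- a x) (w - x)`, which is `o(‖w - x‖)` by continuity of `a`. -/
theorem hasFDerivWithinAt_of_subgradient {S : Set F} {f : F → ℝ} {a : F → F →L[ℝ] ℝ} {x : F}
    (hsub : ∀ z ∈ S, ∀ w ∈ S, f z + a z (w - z) ≤ f w) (hx : x ∈ S)
    (ha : ContinuousWithinAt a S x) : HasFDerivWithinAt f (a x) S x := by
  refine HasFDerivWithinAt.of_isLittleO (Asymptotics.isLittleO_iff.2 fun c hc => ?_)
  have h1 := Metric.continuousWithinAt_iff'.1 ha c hc
  filter_upwards [h1, self_mem_nhdsWithin] with w hw hwS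
  have e1 := hsub x hx w hwS
  have e2 := hsub w hwS x hx
  have e3 : (a w - a x) (w - x) ≤ c * ‖w - x‖ := by
    refine (le_abs_self _).trans (((a w - a x).le_opNorm (w - x)).trans ?_)
    rw [← dist_eq_norm (a w)]
    gcongr
  rw [_root_.sub_apply] at e3
  have e4 : a w (x - w) = - a w (w - x) := by rw [← map_neg, neg_sub]
  rw [Real.norm_of_nonneg (by linarith)]
  linarith

theorem HasFDerivAt.eq_of_subgradient {f : F → ℝ} {f' p : F →L[ℝ] ℝ} {x : F}
    (h : HasFDerivAt f f' x) (hp : ∀ᶠ y in 𝓝 x, f x + p (y - x) ≤ f y) : p = f' := by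
  have hmin : IsLocalMin (fun y => f y - p y) x := by
    filter_upwards [hp] with y hy
    rw [map_sub] at hy
    linarith
  have := hmin.hasFDerivAt_eq_zero (h.sub p.hasFDerivAt)
  exact (sub_eq_zero.1 this).symm

end Subgradients

/-! ### Gradient images of strictly convex functions. -/

section Euclidean

variable {n : ℕ}

theorem HasGradientAt.eq_of_subgradient {f : RSpace n → ℝ} {g p x : RSpace n}
    (h : HasGradientAt f g x) (hp : ∀ᶠ y in 𝓝 x, f x + inner ℝ p (y - x) ≤ f y) : p = g := by
  have := h.hasFDerivAt.eq_of_subgradient (p := innerSL ℝ p) (by simpa using hp)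
  refine ext_inner_right ℝ fun v => ?_
  simpa using congrArg (fun l : RSpace n →L[ℝ] ℝ => l v) this

theorem HasGradientAt.add_inner_le {S : Set (RSpace n)} {f : RSpace n → ℝ} {g x y : RSpace n}
    (hf : ConvexOn ℝ S f) (hx : x ∈ S) (hy : y ∈ S) (h : HasGradientAt f g x) :
    f x + inner ℝ g (y - x) ≤ f y := by
  simpa using hf.add_fderivWithin_le hx hy h.hasFDerivAt.hasFDerivWithinAt

theorem HasGradientAt.add_inner_lt {S : Set (RSpace n)} {f : RSpace n → ℝ} {g x y : RSpace n}
    (hf : StrictConvexOn ℝ S f) (hx : x ∈ S) (hy : y ∈ S) (hxy : x ≠ y)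
    (h : HasGradientAt f g x) : f x + inner ℝ g (y - x) < f y := by
  simpa using hf.add_fderivWithin_lt hx hy hxy h.hasFDerivAt.hasFDerivWithinAt

theorem hasGradientAt_of_subgradient {S : Set (RSpace n)} (hS : IsOpen S) {f : RSpace n → ℝ}
    {g : RSpace n → RSpace n} {x : RSpace n}
    (hsub : ∀ z ∈ S, ∀ w ∈ S, f z + inner ℝ (g z) (w - z) ≤ f w) (hx : x ∈ S)
    (hg : ContinuousAt g x) : HasGradientAt f (g x) x := by
  have := hasFDerivWithinAt_of_subgradient (a := fun z => innerSL ℝ (g z)) (by simpa using hsub) hx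
    ((innerSL ℝ).continuous.continuousAt.comp hg).continuousWithinAt
  have h2 := this.hasFDerivAt (hS.mem_nhds hx)
  rw [hasGradientAt_iff_hasFDerivAt]
  exact h2

theorem isBounded_of_forall_inner_le {S : Set (RSpace n)}
    (h : ∀ v : RSpace n, ∃ C : ℝ, ∀ x ∈ S, inner ℝ x v ≤ C) : Bornology.IsBounded S := by
  choose C hC using h
  let e : Fin n → RSpace n := fun i => EuclideanSpace.single i 1
  refine isBounded_iff_forall_norm_le.2
    ⟨∑ i, max (C (e i)) (C (-e i)), fun x hx => ?_⟩
  have hsum : x = ∑ i, x i • e i := by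
    simpa [e] using ((EuclideanSpace.basisFun (Fin n) ℝ).sum_repr x).symm
  have hnorm : ‖x‖ ≤ ∑ i, |x i| := by
    conv_lhs => rw [hsum]
    refine (norm_sum_le _ _).trans (Finset.sum_le_sum fun i _ => ?_)
    simp [e, norm_smul]
  refine hnorm.trans (Finset.sum_le_sum fun i _ => ?_)
  have h1 := hC (e i) x hx
  have h2 := hC (-e i) x hx
  rw [inner_neg_right] at h2
  have h3 : inner ℝ x (e i) = x i := by simp [e, EuclideanSpace.inner_single_right]
  rw [h3] at h1 h2
  rcases abs_cases (x i) with ⟨h, _⟩ | ⟨h, _⟩ <;> rw [h]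
  · exact h1.trans (le_max_left _ _)
  · exact h2.trans (le_max_right _ _)

theorem gradient_eq_of_isLocalMin_sub_inner {f : RSpace n → ℝ} (hf : Differentiable ℝ f)
    {x y : RSpace n} (h : IsLocalMin (fun z => f z - inner ℝ y z) x) : ∇ f x = y := by
  refine ((hf x).hasGradientAt.eq_of_subgradient ?_).symm
  filter_upwards [h] with z hz
  rw [inner_sub_right]
  linarith

/-- The gradient image of a strictly convex differentiable function is open. -/
theorem isOpen_range_gradient {f : RSpace n → ℝ} (hf : Differentiable ℝ f)
    (hc : StrictConvexOn ℝ univ f) : IsOpen (range (∇ f)) := by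
  rw [Metric.isOpen_iff]
  rintro _ ⟨x₀, rfl⟩
  -- `m` is the least excess of `f` over its tangent plane on the unit sphere. Changing the slope by
  -- less than `m` keeps the minimiser of the tilted function off the sphere, hence at a critical
  -- point.
  obtain ⟨m, hm, hsph⟩ : ∃ m > 0, ∀ x ∈ Metric.sphere x₀ 1,
      m ≤ f x - f x₀ - inner ℝ (∇ f x₀) (x - x₀) := by
    rcases (Metric.sphere x₀ (1 : ℝ)).eq_empty_or_nonempty with he | hne
    · exact ⟨1, one_pos, by simp [he]⟩
    · obtain ⟨z, hz, hzm⟩ := (isCompact_sphere x₀ (1 : ℝ)).exists_isMinOn hne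
        (f := fun x => f x - f x₀ - inner ℝ (∇ f x₀) (x - x₀))
        (by have := hf.continuous; fun_prop)
      refine ⟨_, ?_, fun x hx => hzm hx⟩
      have hne : x₀ ≠ z := by
        rintro rfl
        simp at hz
      have := (hf x₀).hasGradientAt.add_inner_lt hc (mem_univ _) (mem_univ z) hne
      dsimp only
      linarith
  refine ⟨m, hm, fun y hy => ?_⟩
  obtain ⟨z, hz, hzm⟩ := (isCompact_closedBall x₀ (1 : ℝ)).exists_isMinOn ⟨x₀, by simp⟩
    (f := fun x => f x - inner ℝ y x) (by have := hf.continuous; fun_prop)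
  have hz1 : z ∈ Metric.ball x₀ 1 := by
    rw [Metric.mem_closedBall] at hz
    rw [Metric.mem_ball]
    refine lt_of_le_of_ne hz fun heq => ?_
    have h1 := hsph z heq
    have h2 : f z - inner ℝ y z ≤ f x₀ - inner ℝ y x₀ := hzm (by simp)
    have h3 : inner ℝ (y - ∇ f x₀) (z - x₀) < m := by
      refine (real_inner_le_norm _ _).trans_lt ?_
      rw [← dist_eq_norm, ← dist_eq_norm, heq, mul_one]
      exact hy
    rw [inner_sub_left, inner_sub_right y] at h3
    linarith
  exact ⟨z, gradient_eq_of_isLocalMin_sub_inner hf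
    (hzm.isLocalMin (mem_of_superset (Metric.isOpen_ball.mem_nhds hz1) Metric.ball_subset_closedBall))⟩

/-- The gradient image of a strictly convex differentiable function is the interior of its
closure, if the latter is convex. -/
theorem range_gradient_eq_interior {f : RSpace n → ℝ} (hf : Differentiable ℝ f)
    (hc : StrictConvexOn ℝ univ f) : range (∇ f) = interior (closure (range (∇ f))) := by
  refine Subset.antisymm
    (interior_maximal subset_closure (isOpen_range_gradient hf hc)) fun y hy => ?_
  -- `D` is the effective domain of the conjugate of `f`. It is convex and contains the gradient
  -- image, and passing to the closure of a convex set with nonempty interior does not enlarge that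
  -- interior.
  let D : Set (RSpace n) := {y | ∃ C : ℝ, ∀ x, C ≤ f x - inner ℝ y x}
  have hRD : range (∇ f) ⊆ D := by
    rintro _ ⟨x₀, rfl⟩
    refine ⟨f x₀ - inner ℝ (∇ f x₀) x₀, fun x => ?_⟩
    have := (hf x₀).hasGradientAt.add_inner_le hc.convexOn (mem_univ _) (mem_univ x)
    rw [inner_sub_right] at this
    linarith
  have hD : Convex ℝ D := by
    rintro y₁ ⟨C₁, h₁⟩ y₂ ⟨C₂, h₂⟩ a b ha hb hab
    refine ⟨a * C₁ + b * C₂, fun x => ?_⟩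
    have e1 := mul_le_mul_of_nonneg_left (h₁ x) ha
    have e2 := mul_le_mul_of_nonneg_left (h₂ x) hb
    have e3 : f x = a * f x + b * f x := by rw [← add_mul, hab, one_mul]
    rw [inner_add_left, real_inner_smul_left, real_inner_smul_left, e3]
    linarith
  have hRint : range (∇ f) ⊆ interior D := interior_maximal hRD (isOpen_range_gradient hf hc)
  have hyD : y ∈ interior D := by
    rw [← hD.interior_closure_eq_interior_of_nonempty_interior ⟨_, hRint ⟨0, rfl⟩⟩]
    exact interior_mono (closure_mono hRD) hy
  obtain ⟨ε, hε, hball⟩ := Metric.mem_nhds_iff.1 (mem_interior_iff_mem_nhds.1 hyD)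
  -- Finiteness of the conjugate at `y + t • v` bounds the sublevel set in the direction `v`. Hence
  -- the tilted function attains its minimum.
  have hbd : Bornology.IsBounded {x | f x - inner ℝ y x ≤ f 0} := by
    refine isBounded_of_forall_inner_le fun v => ?_
    obtain ⟨t, ht, htv⟩ : ∃ t : ℝ, 0 < t ∧ ‖t • v‖ < ε := by
      refine ⟨ε / (2 * (‖v‖ + 1)), by positivity, ?_⟩
      rw [norm_smul, Real.norm_of_nonneg (by positivity), div_mul_eq_mul_div,
        div_lt_iff₀ (by positivity)]
      nlinarith [norm_nonneg v]
    obtain ⟨C, hC⟩ := hball (show y + t • v ∈ Metric.ball y ε by simpa using htv)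
    refine ⟨(f 0 - C) / t, fun x hx => ?_⟩
    have h1 := hC x
    rw [mem_ofPred_eq] at hx
    rw [inner_add_left, real_inner_smul_left] at h1
    rw [le_div_iff₀ ht, real_inner_comm]
    linarith
  have hcont : Continuous fun x => f x - inner ℝ y x := by
    have := hf.continuous
    fun_prop
  have hcpt : IsCompact {x | f x - inner ℝ y x ≤ f 0} :=
    Metric.isCompact_of_isClosed_isBounded (isClosed_le hcont continuous_const) hbd
  obtain ⟨z, hz, hzm⟩ := hcpt.exists_isMinOn ⟨0, by simp⟩ hcont.continuousOn
  refine ⟨z, gradient_eq_of_isLocalMin_sub_inner hf (Eventually.of_forall fun x => ?_)⟩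
  by_cases hx : f x - inner ℝ y x ≤ f 0
  · exact hzm hx
  · exact le_trans hz (not_le.1 hx).le

end Euclidean

/-! ### Convexity criteria and the inverse function theorem. -/

section Subgradients

variable {F : Type*} [NormedAddCommGroup F] [NormedSpace ℝ F]

theorem convexOn_of_forall_exists_subgradient {S : Set F} (hS : Convex ℝ S) {f : F → ℝ}
    (h : ∀ x ∈ S, ∃ l : F →L[ℝ] ℝ, ∀ y ∈ S, f x + l (y - x) ≤ f y) : ConvexOn ℝ S f := by
  refine ⟨hS, fun x hx y hy a b ha hb hab => ?_⟩
  obtain ⟨l, hl⟩ := h _ (hS hx hy ha hb hab)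
  have h1 := mul_le_mul_of_nonneg_left (hl x hx) ha
  have h2 := mul_le_mul_of_nonneg_left (hl y hy) hb
  have h3 : a * l (x - (a • x + b • y)) + b * l (y - (a • x + b • y)) = 0 := by
    rw [← smul_eq_mul, ← smul_eq_mul, ← map_smul, ← map_smul, ← map_add]
    have : a • (x - (a • x + b • y)) + b • (y - (a • x + b • y)) = 0 := by
      obtain rfl : b = 1 - a := by linarith
      module
    rw [this, map_zero]
  have h4 : ∀ c : ℝ, a * c + b * c = c := fun c => by rw [← add_mul, hab, one_mul]
  have h5 := h4 (f (a • x + b • y))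
  simp only [smul_eq_mul]
  linarith

theorem strictConvexOn_univ_of_fderiv_fderiv_pos {f : F → ℝ} (hf : ContDiff ℝ 2 f)
    (hpos : ∀ x v : F, v ≠ 0 → 0 < fderiv ℝ (fderiv ℝ f) x v v) : StrictConvexOn ℝ univ f := by
  refine ⟨convex_univ, fun x _ y _ hxy a b ha hb hab => ?_⟩
  have hv : y - x ≠ 0 := sub_ne_zero.2 hxy.symm
  have hline : ∀ t : ℝ, HasDerivAt (fun t : ℝ => x + t • (y - x)) (y - x) t := fun t => by
    simpa using ((hasDerivAt_id t).smul_const (y - x)).const_add x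
  have hd1 : ∀ t : ℝ, HasDerivAt (fun t : ℝ => f (x + t • (y - x)))
      (fderiv ℝ f (x + t • (y - x)) (y - x)) t := fun t =>
    ((hf.differentiable (by norm_num)) _).hasFDerivAt.comp_hasDerivAt t (hline t)
  have hd2 : ∀ t : ℝ, HasDerivAt (fun t : ℝ => fderiv ℝ f (x + t • (y - x)) (y - x))
      (fderiv ℝ (fderiv ℝ f) (x + t • (y - x)) (y - x) (y - x)) t := fun t => by
    have h1 : Differentiable ℝ (fderiv ℝ f) :=
      (hf.fderiv_right (m := 1) (by norm_num)).differentiable (by norm_num)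
    have h2 := (h1 (x + t • (y - x))).hasFDerivAt.comp_hasDerivAt t (hline t)
    simpa using h2.clm_apply (hasDerivAt_const t (y - x))
  have hc : StrictConvexOn ℝ univ (fun t : ℝ => f (x + t • (y - x))) := by
    refine strictConvexOn_univ_of_deriv2_pos
      (continuous_iff_continuousAt.2 fun t => (hd1 t).continuousAt) fun t => ?_
    have e : deriv (fun t : ℝ => f (x + t • (y - x)))
        = fun t => fderiv ℝ f (x + t • (y - x)) (y - x) := funext fun t => (hd1 t).deriv
    simp only [Function.iterate_succ, Function.iterate_zero, Function.comp_apply, id_eq]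
    rw [e, (hd2 t).deriv]
    exact hpos _ _ hv
  have := hc.2 (mem_univ (0 : ℝ)) (mem_univ (1 : ℝ)) zero_ne_one ha hb hab
  have e : a • x + b • y = x + b • (y - x) := by
    obtain rfl : a = 1 - b := by linarith
    module
  simpa [e] using this

theorem ContDiffAt.exists_local_rightInverse [FiniteDimensional ℝ F] {M : F → F}
    {M' : F →L[ℝ] F} {a : F} (hM : ContDiffAt ℝ ∞ M a) (hM' : HasFDerivAt M M' a)
    (hinj : ∀ v, M' v = 0 → v = 0) :
    ∃ N : F → F, ContDiffAt ℝ ∞ N (M a) ∧ N (M a) = a ∧ ∀ᶠ z in 𝓝 (M a), M (N z) = z := by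
  have : CompleteSpace F := FiniteDimensional.complete ℝ F
  have hi : Function.Injective (M' : F →ₗ[ℝ] F) :=
    (injective_iff_map_eq_zero (M' : F →ₗ[ℝ] F)).2 hinj
  let e : F ≃L[ℝ] F := (LinearEquiv.ofInjectiveEndo (M' : F →ₗ[ℝ] F) hi).toContinuousLinearEquiv
  have he : (e : F →L[ℝ] F) = M' := by
    ext v
    simp [e]
  have hMe : HasFDerivAt M (e : F →L[ℝ] F) a := he ▸ hM'
  have hn : (∞ : WithTop ℕ∞) ≠ 0 := by simp
  refine ⟨hM.localInverse hMe hn, hM.to_localInverse hMe hn, hM.localInverse_apply_image hMe hn, ?_⟩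
  exact (hM.hasStrictFDerivAt' hMe hn).eventually_right_inverse

end Subgradients

/-! ### The Legendre transform on the gradient image. -/

section Legendre

variable {n : ℕ} {f : RSpace n → ℝ}

theorem gradient_injective (hf : Differentiable ℝ f) (hc : StrictConvexOn ℝ univ f) :
    Function.Injective (∇ f) := by
  intro x y hxy
  by_contra hne
  have h1 := (hf x).hasGradientAt.add_inner_lt hc (mem_univ _) (mem_univ y) hne
  have h2 := (hf y).hasGradientAt.add_inner_lt hc (mem_univ _) (mem_univ x) (Ne.symm hne)
  rw [hxy] at h1
  rw [← neg_sub, inner_neg_right] at h2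
  linarith

theorem gradient_invFun {y : RSpace n} (hy : y ∈ range (∇ f)) :
    ∇ f (Function.invFun (∇ f) y) = y :=
  Function.invFun_eq hy

theorem invFun_gradient (hf : Differentiable ℝ f) (hc : StrictConvexOn ℝ univ f) (x : RSpace n) :
    Function.invFun (∇ f) (∇ f x) = x :=
  Function.leftInverse_invFun (gradient_injective hf hc) x

theorem isGreatest_legendre (hf : Differentiable ℝ f) (hc : ConvexOn ℝ univ f) (x : RSpace n) :
    IsGreatest (range fun z => inner ℝ z (∇ f x) - f z) (inner ℝ x (∇ f x) - f x) := by
  refine ⟨⟨x, rfl⟩, ?_⟩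
  rintro _ ⟨z, rfl⟩
  have := (hf x).hasGradientAt.add_inner_le hc (mem_univ _) (mem_univ z)
  rw [inner_sub_right, real_inner_comm, real_inner_comm x] at this
  linarith

theorem legendreTransform_gradient (hf : Differentiable ℝ f) (hc : ConvexOn ℝ univ f)
    (x : RSpace n) : legendreTransform f (∇ f x) = inner ℝ x (∇ f x) - f x :=
  (isGreatest_legendre hf hc x).csSup_eq

theorem legendreTransform_eq (hf : Differentiable ℝ f) (hc : ConvexOn ℝ univ f)
    {y : RSpace n} (hy : y ∈ range (∇ f)) :
    legendreTransform f y
      = inner ℝ (Function.invFun (∇ f) y) y - f (Function.invFun (∇ f) y) := by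
  conv_lhs => rw [← gradient_invFun hy]
  rw [legendreTransform_gradient hf hc, gradient_invFun hy]

theorem inner_sub_le_legendreTransform (hf : Differentiable ℝ f) (hc : ConvexOn ℝ univ f)
    {y : RSpace n} (hy : y ∈ range (∇ f)) (z : RSpace n) :
    inner ℝ z y - f z ≤ legendreTransform f y := by
  obtain ⟨x, rfl⟩ := hy
  rw [legendreTransform_gradient hf hc]
  exact (isGreatest_legendre hf hc x).2 ⟨z, rfl⟩

theorem legendreTransform_subgradient (hf : Differentiable ℝ f) (hc : ConvexOn ℝ univ f)
    {y y' : RSpace n} (hy : y ∈ range (∇ f)) (hy' : y' ∈ range (∇ f)) :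
    legendreTransform f y + inner ℝ (Function.invFun (∇ f) y) (y' - y)
      ≤ legendreTransform f y' := by
  have := inner_sub_le_legendreTransform hf hc hy' (Function.invFun (∇ f) y)
  rw [legendreTransform_eq hf hc hy, inner_sub_right]
  linarith

theorem convexOn_legendreTransform (hf : Differentiable ℝ f) (hc : ConvexOn ℝ univ f)
    (hU : Convex ℝ (range (∇ f))) : ConvexOn ℝ (range (∇ f)) (legendreTransform f) :=
  convexOn_of_forall_exists_subgradient hU fun y hy =>
    ⟨innerSL ℝ (Function.invFun (∇ f) y), fun y' hy' => by
      simpa using legendreTransform_subgradient hf hc hy hy'⟩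

theorem contDiff_gradient (hf : ContDiff ℝ ∞ f) : ContDiff ℝ ∞ (∇ f) :=
  (InnerProductSpace.toDual ℝ (RSpace n)).symm.contDiff.comp
    (hf.fderiv_right (m := ∞) (by simp))

theorem ContDiffOn.gradient {U : Set (RSpace n)} (hf : ContDiffOn ℝ ∞ f U) (hU : IsOpen U) :
    ContDiffOn ℝ ∞ (∇ f) U :=
  (InnerProductSpace.toDual ℝ (RSpace n)).symm.contDiff.comp_contDiffOn
    (hf.fderiv_of_isOpen (m := ∞) hU (by simp))

theorem inner_fderiv_gradient (hf : ContDiff ℝ ∞ f) (x u v : RSpace n) :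
    inner ℝ (fderiv ℝ (∇ f) x u) v = fderiv ℝ (fderiv ℝ f) x u v := by
  have h1 : HasFDerivAt (fderiv ℝ f) (fderiv ℝ (fderiv ℝ f) x) x :=
    ((hf.fderiv_right (m := ∞) (by simp)).differentiable (by simp) x).hasFDerivAt
  have h2 := ((InnerProductSpace.toDual ℝ (RSpace n)).symm.toContinuousLinearEquiv.toContinuousLinearMap.hasFDerivAt
    (x := fderiv ℝ f x)).comp x h1
  have h3 : HasFDerivAt (∇ f) _ x := h2
  rw [h3.fderiv]
  simp

theorem contDiffAt_invFun_gradient (hf : ContDiff ℝ ∞ f)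
    (hpos : ∀ x v : RSpace n, v ≠ 0 → 0 < fderiv ℝ (fderiv ℝ f) x v v)
    (hc : StrictConvexOn ℝ univ f) {y : RSpace n} (hy : y ∈ range (∇ f)) :
    ContDiffAt ℝ ∞ (Function.invFun (∇ f)) y := by
  obtain ⟨x, rfl⟩ := hy
  have hd : Differentiable ℝ f := hf.differentiable (by simp)
  obtain ⟨N, hN, -, hNr⟩ := (contDiff_gradient hf).contDiffAt.exists_local_rightInverse
    ((contDiff_gradient hf).differentiable (by simp) x).hasFDerivAt (fun v hv => by
      by_contra hne
      have := hpos x v hne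
      rw [← inner_fderiv_gradient hf, hv, inner_zero_left] at this
      exact lt_irrefl _ this)
  refine hN.congr_of_eventuallyEq ?_
  filter_upwards [hNr] with z hz
  conv_lhs => rw [← hz]
  exact invFun_gradient hd hc _

/-- The derivative of the inverse gradient at `y` inverts the Hessian `A` at the preimage of `y`.
With `z = A⁻¹ v` one has `⟨A⁻¹ v, v⟩ = ⟨z, A z⟩ > 0`. -/
theorem inner_fderiv_invFun_gradient_pos (hf : ContDiff ℝ ∞ f)
    (hpos : ∀ x v : RSpace n, v ≠ 0 → 0 < fderiv ℝ (fderiv ℝ f) x v v)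
    (hc : StrictConvexOn ℝ univ f) {y : RSpace n} (hy : y ∈ range (∇ f)) {v : RSpace n}
    (hv : v ≠ 0) : 0 < (inner ℝ (fderiv ℝ (Function.invFun (∇ f)) y v) v : ℝ) := by
  have hd : Differentiable ℝ f := hf.differentiable (by simp)
  have hg := ((contDiffAt_invFun_gradient hf hpos hc hy).differentiableAt (by simp)).hasFDerivAt
  have hG := ((contDiff_gradient hf).differentiable (by simp)
    (Function.invFun (∇ f) y)).hasFDerivAt
  have hcomp := hG.comp y hg
  have hid : HasFDerivAt (∇ f ∘ Function.invFun (∇ f)) (ContinuousLinearMap.id ℝ (RSpace n)) y := by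
    refine (hasFDerivAt_id y).congr_of_eventuallyEq ?_
    filter_upwards [(isOpen_range_gradient hd hc).mem_nhds hy] with z hz
    exact gradient_invFun hz
  have hv2 := congrArg (fun l : RSpace n →L[ℝ] RSpace n => l v) (hcomp.unique hid)
  simp only [ContinuousLinearMap.comp_apply, ContinuousLinearMap.id_apply] at hv2
  have hne : fderiv ℝ (Function.invFun (∇ f)) y v ≠ 0 := fun h0 => by
    rw [h0, map_zero] at hv2
    exact hv hv2.symm
  have := hpos (Function.invFun (∇ f) y) _ hne
  rwa [← inner_fderiv_gradient hf, hv2, real_inner_comm] at this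

end Legendre

/-! ### The affine family of dual potentials and its gradient maps. -/

section DualFamily

variable {n : ℕ}

theorem inner_fderiv_nonneg_of_monotone {U : Set (RSpace n)} (hU : IsOpen U)
    {G : RSpace n → RSpace n} {A : RSpace n →L[ℝ] RSpace n} {y : RSpace n} (hy : y ∈ U)
    (hG : HasFDerivAt G A y)
    (hmono : ∀ y' ∈ U, 0 ≤ (inner ℝ (G y' - G y) (y' - y) : ℝ)) (v : RSpace n) :
    0 ≤ (inner ℝ (A v) v : ℝ) := by
  have hline : HasDerivAt (fun t : ℝ => y + t • v) v 0 := by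
    simpa using ((hasDerivAt_id (0 : ℝ)).smul_const v).const_add y
  have hG' : HasFDerivAt G A (y + (0 : ℝ) • v) := by simpa using hG
  have hd : HasDerivAt (fun t : ℝ => (inner ℝ (G (y + t • v)) v : ℝ)) (inner ℝ (A v) v) 0 := by
    simpa using (hG'.comp_hasDerivAt 0 hline).inner ℝ (hasDerivAt_const 0 v)
  have hmem : ∀ᶠ t : ℝ in 𝓝[>] 0, y + t • v ∈ U := by
    refine nhdsWithin_le_nhds (hline.continuousAt.eventually_mem (hU.mem_nhds ?_))
    simpa using hy
  refine ge_of_tendsto hd.tendsto_slope_zero_right ?_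
  filter_upwards [hmem, self_mem_nhdsWithin] with t ht ht0
  have h1 := hmono _ ht
  have ht0' : 0 < t := ht0
  rw [add_sub_cancel_left, real_inner_smul_right] at h1
  have h2 := nonneg_of_mul_nonneg_right h1 ht0'
  rw [inner_sub_left] at h2
  simp only [zero_add, zero_smul, add_zero, smul_eq_mul]
  positivity

/-- Data for an affine family `u - s * w` of potentials on a bounded open convex set `U`, where
`u` is smooth and strongly convex and its gradient `g` is proper. -/
structure IsDualFamily (U : Set (RSpace n)) (u w : RSpace n → ℝ) (g : RSpace n → RSpace n) :
    Prop where
  isOpen : IsOpen U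
  convex : Convex ℝ U
  nonempty : U.Nonempty
  isBounded : Bornology.IsBounded U
  contDiffOn_potential : ContDiffOn ℝ ∞ u U
  contDiffOn_velocity : ContDiffOn ℝ ∞ w U
  hasGradientAt : ∀ y ∈ U, HasGradientAt u (g y) y
  contDiffOn_gradient : ContDiffOn ℝ ∞ g U
  fderiv_pos : ∀ y ∈ U, ∀ v : RSpace n, v ≠ 0 → 0 < (inner ℝ (fderiv ℝ g y v) v : ℝ)
  convexOn : ConvexOn ℝ U u
  strictMono : ∀ y ∈ U, ∀ y' ∈ U, y ≠ y' → 0 < (inner ℝ (g y - g y') (y - y') : ℝ)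
  isCompact : ∀ C : ℝ, IsCompact {y | y ∈ U ∧ ‖g y‖ ≤ C}

variable {U : Set (RSpace n)} {u w : RSpace n → ℝ} {g : RSpace n → RSpace n} {S s : ℝ}

namespace IsDualFamily

theorem contDiffOn_gradient_velocity (h : IsDualFamily U u w g) : ContDiffOn ℝ ∞ (∇ w) U :=
  h.contDiffOn_velocity.gradient h.isOpen

theorem hasGradientAt_sub (h : IsDualFamily U u w g) (s : ℝ) {y : RSpace n} (hy : y ∈ U) :
    HasGradientAt (fun z => u z - s * w z) (g y - s • ∇ w y) y := by
  have hw : HasGradientAt w (∇ w y) y :=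
    ((h.contDiffOn_velocity.contDiffAt (h.isOpen.mem_nhds hy)).differentiableAt
      (by simp)).hasGradientAt
  rw [hasGradientAt_iff_hasFDerivAt] at hw ⊢
  have := (h.hasGradientAt y hy).hasFDerivAt.sub (hw.const_mul s)
  rw [map_sub, map_smul]
  exact this

/-- `u - s w = (1 - s/S) u + (s/S) (u - S w)` is a convex combination. -/
theorem convexOn_sub (h : IsDualFamily U u w g) (hS : 0 < S)
    (hconv : ConvexOn ℝ U fun y => u y - S * w y) (h0 : 0 ≤ s) (hs : s ≤ S) :
    ConvexOn ℝ U fun y => u y - s * w y := by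
  have h1 : 0 ≤ 1 - s / S := by
    rw [sub_nonneg, div_le_one hS]
    exact hs
  refine ((h.convexOn.smul h1).add (hconv.smul (div_nonneg h0 hS.le))).congr fun y _ => ?_
  simp only [Pi.add_apply, smul_eq_mul]
  field_simp
  ring

theorem monotone_gradient_sub (h : IsDualFamily U u w g)
    (hconv : ConvexOn ℝ U fun y => u y - S * w y) {y y' : RSpace n} (hy : y ∈ U) (hy' : y' ∈ U) :
    0 ≤ (inner ℝ ((g y - S • ∇ w y) - (g y' - S • ∇ w y')) (y - y') : ℝ) := by
  have h1 := (h.hasGradientAt_sub S hy).add_inner_le hconv hy hy'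
  have h2 := (h.hasGradientAt_sub S hy').add_inner_le hconv hy' hy
  rw [← neg_sub y y', inner_neg_right] at h1
  rw [inner_sub_left (_ - _)]
  linarith

/-- The same convex combination at the level of gradients: the part from time `S` is monotone, so
the factor `1 - s/S` of the monotonicity of `g` survives. -/
theorem strongMono (h : IsDualFamily U u w g) (hS : 0 < S)
    (hconv : ConvexOn ℝ U fun y => u y - S * w y) (h0 : 0 ≤ s) {y y' : RSpace n}
    (hy : y ∈ U) (hy' : y' ∈ U) :
    (1 - s / S) * (inner ℝ (g y - g y') (y - y') : ℝ)
      ≤ inner ℝ ((g y - s • ∇ w y) - (g y' - s • ∇ w y')) (y - y') := by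
  have h1 := mul_nonneg (div_nonneg h0 hS.le) (h.monotone_gradient_sub hconv hy hy')
  have e : (g y - s • ∇ w y) - (g y' - s • ∇ w y') = (1 - s / S) • (g y - g y')
      + (s / S) • ((g y - S • ∇ w y) - (g y' - S • ∇ w y')) := by
    have : s = s / S * S := by field_simp
    conv_lhs => rw [this]
    module
  rw [e, inner_add_left, real_inner_smul_left, real_inner_smul_left]
  linarith

theorem injOn (h : IsDualFamily U u w g) (hS : 0 < S)
    (hconv : ConvexOn ℝ U fun y => u y - S * w y) (h0 : 0 ≤ s) (hs : s < S) :
    InjOn (fun y => g y - s • ∇ w y) U := by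
  intro y hy y' hy' heq
  by_contra hne
  have h1 := h.strongMono hS hconv h0 hy hy'
  have h2 := h.strictMono y hy y' hy' hne
  have h3 : 0 < 1 - s / S := by
    rw [sub_pos, div_lt_one hS]
    exact hs
  dsimp only at heq
  rw [heq, sub_self, inner_zero_left] at h1
  exact absurd h1 (not_le.2 (mul_pos h3 h2))

theorem gradient_eq_of_isMaxOn (h : IsDualFamily U u w g) {x y : RSpace n} (hy : y ∈ U)
    (hmax : ∀ y' ∈ U, inner ℝ x y' - (u y' - s * w y') ≤ inner ℝ x y - (u y - s * w y)) :
    g y - s • ∇ w y = x := by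
  refine ((h.hasGradientAt_sub s hy).eq_of_subgradient ?_).symm
  filter_upwards [h.isOpen.mem_nhds hy] with y' hy'
  have := hmax y' hy'
  rw [inner_sub_right]
  linarith

theorem isMaxOn_of_gradient_eq (h : IsDualFamily U u w g) (hS : 0 < S)
    (hconv : ConvexOn ℝ U fun y => u y - S * w y) (h0 : 0 ≤ s) (hs : s ≤ S) {x y : RSpace n}
    (hy : y ∈ U) (hxy : g y - s • ∇ w y = x) {y' : RSpace n} (hy' : y' ∈ U) :
    inner ℝ x y' - (u y' - s * w y') ≤ inner ℝ x y - (u y - s * w y) := by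
  have := (h.hasGradientAt_sub s hy).add_inner_le (h.convexOn_sub hS hconv h0 hs) hy hy'
  rw [hxy, inner_sub_right] at this
  linarith

theorem hasFDerivAt_gradient (h : IsDualFamily U u w g) {y : RSpace n} (hy : y ∈ U) :
    HasFDerivAt g (fderiv ℝ g y) y :=
  ((h.contDiffOn_gradient.contDiffAt (h.isOpen.mem_nhds hy)).differentiableAt
    (by simp)).hasFDerivAt

theorem hasFDerivAt_gradient_velocity (h : IsDualFamily U u w g) {y : RSpace n} (hy : y ∈ U) :
    HasFDerivAt (∇ w) (fderiv ℝ (∇ w) y) y :=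
  ((h.contDiffOn_gradient_velocity.contDiffAt (h.isOpen.mem_nhds hy)).differentiableAt
    (by simp)).hasFDerivAt

theorem inner_fderiv_pos (h : IsDualFamily U u w g) (hS : 0 < S)
    (hconv : ConvexOn ℝ U fun y => u y - S * w y) (h0 : 0 ≤ s) (hs : s < S) {y : RSpace n}
    (hy : y ∈ U) {v : RSpace n} (hv : v ≠ 0) :
    0 < (inner ℝ (fderiv ℝ g y v - s • fderiv ℝ (∇ w) y v) v : ℝ) := by
  have h1 := inner_fderiv_nonneg_of_monotone h.isOpen hy
    ((h.hasFDerivAt_gradient hy).sub ((h.hasFDerivAt_gradient_velocity hy).const_smul S))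
    (fun y' hy' => h.monotone_gradient_sub hconv hy' hy) v
  have h2 := h.fderiv_pos y hy v hv
  have h3 : 0 < 1 - s / S := by
    rw [sub_pos, div_lt_one hS]
    exact hs
  have h4 := mul_nonneg (div_nonneg h0 hS.le) h1
  have h5 := mul_pos h3 h2
  have e : s = s / S * S := by field_simp
  simp only [_root_.sub_apply, _root_.smul_apply, inner_sub_left, real_inner_smul_left] at h4 ⊢
  rw [mul_sub, ← mul_assoc, ← e] at h4
  linarith

/-- Smooth dependence of `(∇(u - s * w))⁻¹ x` on `(s, x)`. -/
theorem contDiffOn_inverse (h : IsDualFamily U u w g) (hS : 0 < S)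
    (hconv : ConvexOn ℝ U fun y => u y - S * w y) {I : Set ℝ} (hI : I ⊆ Ico 0 S)
    {Y : ℝ × RSpace n → RSpace n}
    (hY : ∀ s ∈ I, ∀ x, Y (s, x) ∈ U ∧ g (Y (s, x)) - s • ∇ w (Y (s, x)) = x) :
    ContDiffOn ℝ ∞ Y (I ×ˢ univ) := by
  rintro ⟨s, x⟩ ⟨hs, -⟩
  dsimp only at hs
  obtain ⟨hyU, hyx⟩ := hY s hs x
  set y := Y (s, x) with hydef
  -- Time is kept as a coordinate, so the derivative of `M` is block triangular and its kernel is
  -- that of the Hessian of `u - s w`.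
  let M : ℝ × RSpace n → ℝ × RSpace n := fun p => (p.1, g p.2 - p.1 • ∇ w p.2)
  have hMa : M (s, y) = (s, x) := by simp [M, hyx]
  have hgc : ContDiffAt ℝ ∞ g y := h.contDiffOn_gradient.contDiffAt (h.isOpen.mem_nhds hyU)
  have hkc : ContDiffAt ℝ ∞ (∇ w) y :=
    h.contDiffOn_gradient_velocity.contDiffAt (h.isOpen.mem_nhds hyU)
  have hM : ContDiffAt ℝ ∞ M (s, y) := by
    refine contDiffAt_fst.prodMk (ContDiffAt.sub ?_ (contDiffAt_fst.smul ?_))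
    · exact ContDiffAt.comp (s, y) (g := g) hgc contDiffAt_snd
    · exact ContDiffAt.comp (s, y) (g := ∇ w) hkc contDiffAt_snd
  have hgd : HasFDerivAt (fun p : ℝ × RSpace n => g p.2) _ (s, y) :=
    HasFDerivAt.comp (s, y) (g := g) (h.hasFDerivAt_gradient hyU) hasFDerivAt_snd
  have hkd : HasFDerivAt (fun p : ℝ × RSpace n => ∇ w p.2) _ (s, y) :=
    HasFDerivAt.comp (s, y) (g := ∇ w) (h.hasFDerivAt_gradient_velocity hyU) hasFDerivAt_snd
  have hM' := (hasFDerivAt_fst (𝕜 := ℝ) (p := (s, y))).prodMk (hgd.sub (hasFDerivAt_fst.smul hkd))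
  obtain ⟨N, hN, hNa, hNr⟩ := hM.exists_local_rightInverse hM' (by
    rintro ⟨a, v⟩ hav
    simp only [ContinuousLinearMap.prod_apply, Prod.mk_eq_zero, ContinuousLinearMap.coe_fst',
      _root_.sub_apply, ContinuousLinearMap.comp_apply, ContinuousLinearMap.coe_snd',
      _root_.add_apply, _root_.smul_apply, ContinuousLinearMap.smulRight_apply] at hav
    obtain ⟨rfl, h2⟩ := hav
    rw [zero_smul, add_zero] at h2
    refine Prod.mk_eq_zero.2 ⟨rfl, ?_⟩
    by_contra hv
    have := h.inner_fderiv_pos hS hconv (hI hs).1 (hI hs).2 hyU hv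
    rw [h2, inner_zero_left] at this
    exact lt_irrefl _ this)
  rw [hMa] at hN hNa hNr
  -- Injectivity holds only on `U`. Once the local inverse lands there, it agrees with `Y` at all
  -- nearby times in `I`, which need not be open.
  have hNU : ∀ᶠ p in 𝓝 (s, x), (N p).2 ∈ U := by
    refine (continuous_snd.continuousAt.comp hN.continuousAt).eventually_mem (h.isOpen.mem_nhds ?_)
    simpa [hNa] using hyU
  refine (hN.snd.contDiffWithinAt).congr_of_eventuallyEq ?_ (by simp [hNa, hydef])
  filter_upwards [nhdsWithin_le_nhds hNr, nhdsWithin_le_nhds hNU, self_mem_nhdsWithin]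
    with ⟨s', x'⟩ h1 h2 ⟨h3, _⟩
  dsimp only at h3
  obtain ⟨e1, e2⟩ := Prod.mk.inj h1
  rw [e1] at e2
  obtain ⟨h4, h5⟩ := hY s' h3 x'
  exact h.injOn hS hconv (hI h3).1 (hI h3).2 h4 h2 (h5.trans e2.symm)

theorem contDiffOn_conjugate (h : IsDualFamily U u w g) {D : Set (ℝ × RSpace n)}
    {Y : ℝ × RSpace n → RSpace n} (hY : ContDiffOn ℝ ∞ Y D) (hYU : MapsTo Y D U) :
    ContDiffOn ℝ ∞ (fun p => inner ℝ p.2 (Y p) - (u (Y p) - p.1 * w (Y p))) D :=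
  (contDiffOn_snd.inner ℝ hY).sub ((h.contDiffOn_potential.comp hY hYU).sub
    (contDiffOn_fst.mul (h.contDiffOn_velocity.comp hY hYU)))

/-- This is properness of `g - s ∇w`. Strong monotonicity against a fixed `z` bounds `⟨g y, y - z⟩`
above, and monotonicity of `g` against `z + t • v` bounds `⟨g y, y - z - t • v⟩` below. The
difference bounds `⟨g y, v⟩` above for every direction `v`. -/
theorem exists_gradient_bound (h : IsDualFamily U u w g) (hS : 0 < S)
    (hconv : ConvexOn ℝ U fun y => u y - S * w y) (h0 : 0 ≤ s) (hs : s < S) (R : ℝ) :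
    ∃ C : ℝ, ∀ y ∈ U, ‖g y - s • ∇ w y‖ ≤ R → ‖g y‖ ≤ C := by
  obtain ⟨z, hz⟩ := h.nonempty
  obtain ⟨B, hB⟩ := isBounded_iff_forall_norm_le.1 h.isBounded
  have hB2 : ∀ y ∈ U, ∀ y' ∈ U, ‖y - y'‖ ≤ 2 * B := fun y hy y' hy' => by
    have := norm_sub_le y y'
    have := hB y hy
    have := hB y' hy'
    linarith
  have hc : 0 < 1 - s / S := by
    rw [sub_pos, div_lt_one hS]
    exact hs
  have hbd : Bornology.IsBounded (g '' {y | y ∈ U ∧ ‖g y - s • ∇ w y‖ ≤ R}) := by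
    refine isBounded_of_forall_inner_le fun v => ?_
    obtain ⟨t, ht, htv⟩ : ∃ t : ℝ, 0 < t ∧ z + t • v ∈ U := by
      have hcont : ContinuousAt (fun t : ℝ => z + t • v) 0 := by fun_prop
      have : ∀ᶠ t : ℝ in 𝓝[>] 0, z + t • v ∈ U :=
        nhdsWithin_le_nhds (hcont.eventually_mem (h.isOpen.mem_nhds (by simpa using hz)))
      obtain ⟨t, h1, h2⟩ := (this.and self_mem_nhdsWithin).exists
      exact ⟨t, h2, h1⟩
    set z' := z + t • v with hz'
    refine ⟨((R + ‖g z - s • ∇ w z‖) * (2 * B) / (1 - s / S) + ‖g z‖ * (2 * B)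
      + ‖g z'‖ * (2 * B)) / t, ?_⟩
    rintro _ ⟨y, ⟨hy, hyR⟩, rfl⟩
    have hB0 := hB2 y hy z hz
    have h1 : inner ℝ (g y - g z) (y - z)
        ≤ (R + ‖g z - s • ∇ w z‖) * (2 * B) / (1 - s / S) := by
      rw [le_div_iff₀ hc, mul_comm]
      refine (h.strongMono hS hconv h0 hy hz).trans ((real_inner_le_norm _ _).trans ?_)
      gcongr
      · exact (norm_nonneg _).trans ((norm_sub_le _ _).trans (add_le_add_left hyR _))
      · exact (norm_sub_le _ _).trans (add_le_add_left hyR _)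
    have h2 : inner ℝ (g z) (y - z) ≤ ‖g z‖ * (2 * B) :=
      (real_inner_le_norm _ _).trans (by gcongr)
    have h3 : 0 ≤ (inner ℝ (g y - g z') (y - z') : ℝ) := by
      rcases eq_or_ne y z' with rfl | hne
      · simp
      · exact (h.strictMono y hy z' htv hne).le
    have h4 : -(inner ℝ (g z') (y - z') : ℝ) ≤ ‖g z'‖ * (2 * B) := by
      rw [← inner_neg_right, neg_sub]
      refine (real_inner_le_norm _ _).trans ?_
      have := hB2 z' htv y hy
      gcongr
    have h5 : t * inner ℝ (g y) v = inner ℝ (g y) (y - z) - inner ℝ (g y) (y - z') := by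
      rw [← inner_sub_right, sub_sub_sub_cancel_left, hz', add_sub_cancel_left,
        real_inner_smul_right]
    rw [le_div_iff₀ ht, mul_comm, h5]
    rw [inner_sub_left] at h1 h3
    linarith
  obtain ⟨C, hC⟩ := isBounded_iff_forall_norm_le.1 hbd
  exact ⟨C, fun y hy hyR => hC _ ⟨y, ⟨hy, hyR⟩, rfl⟩⟩

/-- The image is nonempty, closed by the gradient bound and compactness, and open by the inverse
function theorem. Connectedness of `ℝⁿ` concludes. -/
theorem image_gradient_sub_eq_univ (h : IsDualFamily U u w g) (hS : 0 < S)
    (hconv : ConvexOn ℝ U fun y => u y - S * w y) (h0 : 0 ≤ s) (hs : s < S) :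
    (fun y => g y - s • ∇ w y) '' U = univ := by
  set G : RSpace n → RSpace n := fun y => g y - s • ∇ w y with hG
  have hGc : ContDiffOn ℝ ∞ G U :=
    h.contDiffOn_gradient.sub (h.contDiffOn_gradient_velocity.const_smul s)
  refine IsClopen.eq_univ ⟨?_, ?_⟩ (h.nonempty.image _)
  · refine isClosed_of_closure_subset fun x hx => ?_
    obtain ⟨C, hC⟩ := h.exists_gradient_bound hS hconv h0 hs (‖x‖ + 1)
    have hx1 : x ∈ closure (Metric.ball x 1 ∩ G '' U) :=
      Metric.isOpen_ball.inter_closure ⟨by simp, hx⟩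
    have hsub : Metric.ball x 1 ∩ G '' U ⊆ G '' {y | y ∈ U ∧ ‖g y‖ ≤ C} := by
      rintro _ ⟨hb, y, hy, rfl⟩
      refine ⟨y, ⟨hy, hC y hy ?_⟩, rfl⟩
      rw [Metric.mem_ball, dist_eq_norm] at hb
      have := norm_sub_norm_le (G y) x
      exact (by linarith : ‖G y‖ ≤ ‖x‖ + 1)
    have hcl : IsClosed (G '' {y | y ∈ U ∧ ‖g y‖ ≤ C}) :=
      ((h.isCompact C).image_of_continuousOn (hGc.continuousOn.mono fun y hy => hy.1)).isClosed
    exact image_mono (fun y hy => hy.1) (closure_minimal hsub hcl hx1)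
  · rw [isOpen_iff_mem_nhds]
    rintro _ ⟨y, hy, rfl⟩
    obtain ⟨N, hN, hNa, hNr⟩ := ContDiffAt.exists_local_rightInverse (M := G)
      (hGc.contDiffAt (h.isOpen.mem_nhds hy))
      ((h.hasFDerivAt_gradient hy).sub ((h.hasFDerivAt_gradient_velocity hy).const_smul s))
      (fun v hv => by
        by_contra hne
        have := h.inner_fderiv_pos hS hconv h0 hs hy hne
        simp only [_root_.sub_apply, _root_.smul_apply] at hv
        rw [hv, inner_zero_left] at this
        exact lt_irrefl _ this)
    have hNU : ∀ᶠ p in 𝓝 (G y), N p ∈ U :=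
      hN.continuousAt.eventually_mem (h.isOpen.mem_nhds (by rwa [hNa]))
    filter_upwards [hNr, hNU] with z h1 h2
    exact ⟨N z, h2, h1⟩

end IsDualFamily

end DualFamily

/-! ### Construction of the solution by conjugating `u - s w`. -/

section Existence

variable {n : ℕ}

theorem isDualFamily_legendreTransform {P : Set (RSpace n)} (hPc : IsCompact P)
    (hPconv : Convex ℝ P) {ψ₀ ψ₁ : RSpace n → ℝ} (hψ₀ : ContDiff ℝ ∞ ψ₀)
    (hHess : ∀ x v : RSpace n, v ≠ 0 → 0 < fderiv ℝ (fderiv ℝ ψ₀) x v v)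
    (hIm : closure (range (∇ ψ₀)) = P) (hψ₁ : ContDiff ℝ ∞ ψ₁) :
    IsDualFamily (range (∇ ψ₀)) (legendreTransform ψ₀)
      (fun y => ψ₁ (Function.invFun (∇ ψ₀) y)) (Function.invFun (∇ ψ₀)) := by
  have hc : StrictConvexOn ℝ univ ψ₀ :=
    strictConvexOn_univ_of_fderiv_fderiv_pos (contDiff_infty.1 hψ₀ 2) hHess
  have hd : Differentiable ℝ ψ₀ := hψ₀.differentiable (by simp)
  have hU := isOpen_range_gradient hd hc
  have hconv : Convex ℝ (range (∇ ψ₀)) := by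
    rw [range_gradient_eq_interior hd hc, hIm]
    exact hPconv.interior
  have hg : ContDiffOn ℝ ∞ (Function.invFun (∇ ψ₀)) (range (∇ ψ₀)) := fun y hy =>
    (contDiffAt_invFun_gradient hψ₀ hHess hc hy).contDiffWithinAt
  have hgrad : ∀ y ∈ range (∇ ψ₀),
      HasGradientAt (legendreTransform ψ₀) (Function.invFun (∇ ψ₀) y) y := fun y hy =>
    hasGradientAt_of_subgradient hU
      (fun z hz z' hz' => legendreTransform_subgradient hd hc.convexOn hz hz') hy
      (contDiffAt_invFun_gradient hψ₀ hHess hc hy).continuousAt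
  refine ⟨hU, hconv, range_nonempty _, ?_, ?_, hψ₁.comp_contDiffOn hg, hgrad, hg,
    fun y hy v hv => inner_fderiv_invFun_gradient_pos hψ₀ hHess hc hy hv,
    convexOn_legendreTransform hd hc.convexOn hconv, ?_, fun C => ?_⟩
  · exact hPc.isBounded.subset (hIm ▸ subset_closure)
  · exact ((hg.inner ℝ contDiffOn_id).sub (hψ₀.comp_contDiffOn hg)).congr fun y hy =>
      legendreTransform_eq hd hc.convexOn hy
  · rintro _ ⟨x, rfl⟩ _ ⟨x', rfl⟩ hne
    rw [invFun_gradient hd hc, invFun_gradient hd hc]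
    have hne' : x ≠ x' := fun h => hne (h ▸ rfl)
    have h1 := (hd x).hasGradientAt.add_inner_lt hc (mem_univ _) (mem_univ x') hne'
    have h2 := (hd x').hasGradientAt.add_inner_lt hc (mem_univ _) (mem_univ x) hne'.symm
    rw [← neg_sub, inner_neg_right] at h1
    rw [real_inner_comm, inner_sub_left]
    linarith
  -- A sublevel set of `‖(∇ψ₀)⁻¹‖` is the image under `∇ψ₀` of a closed ball.
  · have : {y | y ∈ range (∇ ψ₀) ∧ ‖Function.invFun (∇ ψ₀) y‖ ≤ C}
        = ∇ ψ₀ '' Metric.closedBall 0 C := by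
      ext y
      constructor
      · rintro ⟨⟨x, rfl⟩, hx⟩
        rw [invFun_gradient hd hc] at hx
        exact ⟨x, by simpa using hx, rfl⟩
      · rintro ⟨x, hx, rfl⟩
        refine ⟨⟨x, rfl⟩, ?_⟩
        rw [invFun_gradient hd hc]
        simpa using hx
    rw [this]
    exact (isCompact_closedBall _ _).image (contDiff_gradient hψ₀).continuous

/-- The linear functional on space-time with time slope `a` and spatial slope `y`. -/
noncomputable def spaceTimeFunctional (a : ℝ) (y : RSpace n) : ℝ × RSpace n →L[ℝ] ℝ :=
  a • ContinuousLinearMap.fst ℝ ℝ (RSpace n)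
    + (innerSL ℝ y).comp (ContinuousLinearMap.snd ℝ ℝ (RSpace n))

@[simp]
theorem spaceTimeFunctional_apply (a : ℝ) (y : RSpace n) (p : ℝ × RSpace n) :
    spaceTimeFunctional a y p = a * p.1 + inner ℝ y p.2 := by
  simp [spaceTimeFunctional]

theorem mem_slab {T : ℝ} {p : ℝ × RSpace n} : p ∈ slab n T ↔ p.1 ∈ Icc 0 T := by
  simp [slab]

theorem convex_slab (T : ℝ) : Convex ℝ (slab n T) :=
  (convex_Icc 0 T).prod convex_univ

theorem slab_mem_nhds {T : ℝ} {p : ℝ × RSpace n} (hp : p.1 ∈ Ioo 0 T) : slab n T ∈ 𝓝 p :=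
  prod_mem_nhds (Icc_mem_nhds hp.1 hp.2) univ_mem

theorem volume_graph_eq_zero {U : Set (RSpace n)} (hU : IsOpen U) {w : RSpace n → ℝ}
    (hw : ContinuousOn w U) : volume {p : ℝ × RSpace n | p.2 ∈ U ∧ p.1 = w p.2} = 0 := by
  classical
  let W : RSpace n → ℝ := U.piecewise w 0
  have hW : Measurable W := hw.measurable_piecewise continuousOn_const hU.measurableSet
  have hm : MeasurableSet {p : ℝ × RSpace n | p.1 = W p.2} :=
    measurableSet_eq_fun measurable_fst (hW.comp measurable_snd)
  refine measure_mono_null (t := {p : ℝ × RSpace n | p.1 = W p.2}) ?_ ?_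
  · rintro p ⟨h1, h2⟩
    have : W p.2 = w p.2 := piecewise_eq_of_mem _ _ _ h1
    exact h2.trans this.symm
  · rw [Measure.volume_eq_prod, Measure.prod_apply_symm hm]
    refine (lintegral_congr fun y => ?_).trans lintegral_zero
    have : (fun a : ℝ => (a, y)) ⁻¹' {p : ℝ × RSpace n | p.1 = W p.2} = {W y} := by
      ext a
      rfl
    rw [this]
    exact measure_singleton _

/-- `Y (s, x)` is the point of `U` where `∇(u - s w) = x`, and `η (s, ·)` is the conjugate of `u - s
w`. As a supremum of functions affine in `(s, x)`, `η` is convex, with space-time gradient `(w (Y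
p), Y p)`. -/
theorem exists_isAdmissibleC1Solution {P : Set (RSpace n)} (hPc : IsCompact P)
    (hPconv : Convex ℝ P) {ψ₀ ψ₁ : RSpace n → ℝ} (hψ₀ : ContDiff ℝ ∞ ψ₀)
    (hHess : ∀ x v : RSpace n, v ≠ 0 → 0 < fderiv ℝ (fderiv ℝ ψ₀) x v v)
    (hIm : closure (range (∇ ψ₀)) = P) (hψ₁ : ContDiff ℝ ∞ ψ₁) {T S : ℝ} (hT : 0 < T)
    (hTS : T < S) (hconv : ConvexOn ℝ (range (∇ ψ₀))
      (fun y => legendreTransform ψ₀ y - S * ψ₁ (Function.invFun (∇ ψ₀) y))) :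
    ∃ η, IsAdmissibleC1Solution ψ₀ ψ₁ P T η := by
  have h := isDualFamily_legendreTransform hPc hPconv hψ₀ hHess hIm hψ₁
  have hc : StrictConvexOn ℝ univ ψ₀ :=
    strictConvexOn_univ_of_fderiv_fderiv_pos (contDiff_infty.1 hψ₀ 2) hHess
  have hd : Differentiable ℝ ψ₀ := hψ₀.differentiable (by simp)
  have hS : 0 < S := hT.trans hTS
  set U := range (∇ ψ₀) with hUdef
  set u := legendreTransform ψ₀ with hu
  set g := Function.invFun (∇ ψ₀) with hg
  set w : RSpace n → ℝ := fun y => ψ₁ (g y) with hw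
  have hex : ∀ p ∈ slab n T, ∃ y, y ∈ U ∧ g y - p.1 • ∇ w y = p.2 := fun p hp => by
    rw [mem_slab] at hp
    have := h.image_gradient_sub_eq_univ hS hconv hp.1 (hp.2.trans_lt hTS)
    obtain ⟨y, hy, hyx⟩ := this.symm ▸ mem_univ p.2
    exact ⟨y, hy, hyx⟩
  choose! Y hYU hYx using hex
  have hYc : ContDiffOn ℝ ∞ Y (slab n T) :=
    h.contDiffOn_inverse hS hconv (fun s hs => ⟨hs.1, hs.2.trans_lt hTS⟩) fun s hs x =>
      ⟨hYU (s, x) (mem_slab.2 hs), hYx (s, x) (mem_slab.2 hs)⟩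
  have hYuniq : ∀ p ∈ slab n T, ∀ y ∈ U, g y - p.1 • ∇ w y = p.2 → Y p = y := by
    intro p hp y hy hyx
    have hp' := mem_slab.1 hp
    exact h.injOn hS hconv hp'.1 (hp'.2.trans_lt hTS) (hYU p hp) hy ((hYx p hp).trans hyx.symm)
  let η : ℝ × RSpace n → ℝ := fun p => inner ℝ p.2 (Y p) - (u (Y p) - p.1 * w (Y p))
  have hηc : ContDiffOn ℝ ∞ η (slab n T) := h.contDiffOn_conjugate hYc hYU
  have hmax : ∀ p ∈ slab n T, ∀ y ∈ U, inner ℝ p.2 y - (u y - p.1 * w y) ≤ η p := by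
    intro p hp y hy
    have hp' := mem_slab.1 hp
    exact h.isMaxOn_of_gradient_eq hS hconv hp'.1 (hp'.2.trans hTS.le) (hYU p hp) (hYx p hp) hy
  let a : ℝ × RSpace n → ℝ × RSpace n →L[ℝ] ℝ := fun p => spaceTimeFunctional (w (Y p)) (Y p)
  have hsub : ∀ p ∈ slab n T, ∀ q ∈ slab n T, η p + a p (q - p) ≤ η q := by
    intro p hp q hq
    have := hmax q hq (Y p) (hYU p hp)
    simp only [a, η, spaceTimeFunctional_apply, Prod.fst_sub, Prod.snd_sub, inner_sub_right]
    rw [real_inner_comm q.2, real_inner_comm p.2] at *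
    linarith
  have hac : ContinuousOn a (slab n T) := by
    have h1 : ContinuousOn (fun p => w (Y p)) (slab n T) :=
      h.contDiffOn_velocity.continuousOn.comp hYc.continuousOn hYU
    exact (h1.smul continuousOn_const).add
      (((innerSL ℝ).continuous.comp_continuousOn hYc.continuousOn).clm_comp continuousOn_const)
  have hηd : ∀ p ∈ slab n T, HasFDerivWithinAt η (a p) (slab n T) p := fun p hp =>
    hasFDerivWithinAt_of_subgradient hsub hp (hac p hp)
  have hηconv : ConvexOn ℝ (slab n T) η :=
    convexOn_of_forall_exists_subgradient (convex_slab T) fun p hp => ⟨a p, hsub p hp⟩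
  have hηx : ∀ s ∈ Icc 0 T, ∀ x, HasGradientAt (fun x => η (s, x)) (Y (s, x)) x := by
    intro s hs x
    have h1 : HasFDerivWithinAt (fun x : RSpace n => (s, x))
        (ContinuousLinearMap.inr ℝ ℝ (RSpace n)) univ x :=
      (hasFDerivAt_prodMk_right s x).hasFDerivWithinAt
    have h2 := (hηd (s, x) (mem_slab.2 hs)).comp x h1 (fun z _ => mem_slab.2 hs)
    rw [hasGradientAt_iff_hasFDerivAt, ← hasFDerivWithinAt_univ]
    have e : InnerProductSpace.toDual ℝ (RSpace n) (Y (s, x))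
        = (a (s, x)).comp (ContinuousLinearMap.inr ℝ ℝ (RSpace n)) := by
      ext v
      simp [a]
    rw [e]
    exact h2
  have h0 : (0 : ℝ) ∈ Icc 0 T := ⟨le_rfl, hT.le⟩
  have hY0 : ∀ x, Y (0, x) = ∇ ψ₀ x := fun x =>
    hYuniq (0, x) (mem_slab.2 h0) _ ⟨x, rfl⟩ (by simp [hg, invFun_gradient hd hc])
  have hpt : ∀ s ∈ Icc 0 T, ∀ x y, y ∈ subdifferential (fun x' => η (s, x')) x ↔ y = Y (s, x) := by
    intro s hs x y
    constructor
    · intro hy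
      exact (hηx s hs x).eq_of_subgradient (Eventually.of_forall hy)
    · rintro rfl x'
      simpa [a] using hsub (s, x) (mem_slab.2 hs) (s, x') (mem_slab.2 hs)
  refine ⟨η, ⟨⟨⟨hηconv, fun x => ?_, fun x => ?_, fun s hs => ?_, fun s hs => ?_⟩,
    ⟨hηconv, ?_⟩⟩, hηc.of_le (by exact_mod_cast le_top)⟩⟩
  · simp only [η, hY0, hu, legendreTransform_gradient hd hc.convexOn]
    ring
  · have h1 : HasDerivWithinAt (fun s : ℝ => (s, x)) ((1 : ℝ), (0 : RSpace n)) (Icc 0 T) 0 :=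
      ((hasDerivAt_id (0 : ℝ)).prodMk (hasDerivAt_const 0 x)).hasDerivWithinAt
    have h2 := (hηd (0, x) (mem_slab.2 h0)).comp_hasDerivWithinAt (0 : ℝ) h1
      (fun s hs => mem_slab.2 hs)
    simpa [a, hY0, hw, hg, invFun_gradient hd hc, Function.comp_def] using h2
  · refine ⟨convex_univ, fun x₁ _ x₂ _ hne α β hα hβ hαβ => ?_⟩
    set x := α • x₁ + β • x₂ with hx
    set y := Y (s, x) with hy
    have hp : ∀ z, (s, z) ∈ slab n T := fun z => mem_slab.2 hs
    -- Equality would make `y` the gradient at `z` as well, but the gradient determines the point: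
    -- `x = g y - s • ∇ w y`.
    have hlt : ∀ z, z ≠ x → η (s, x) + inner ℝ y (z - x) < η (s, z) := by
      intro z hz
      have hle : η (s, x) + inner ℝ y (z - x) ≤ η (s, z) := by
        simpa [a] using hsub (s, x) (hp x) (s, z) (hp z)
      refine lt_of_le_of_ne hle fun heq => hz ?_
      have hzy : y = Y (s, z) := by
        refine (hηx s hs z).eq_of_subgradient (Eventually.of_forall fun z' => ?_)
        have h3 : η (s, x) + inner ℝ y (z' - x) ≤ η (s, z') := by
          simpa [a] using hsub (s, x) (hp x) (s, z') (hp z')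
        simp only [inner_sub_right] at heq h3 ⊢
        linarith
      have h4 := hYx (s, z) (hp z)
      rw [← hzy] at h4
      exact h4.symm.trans (hYx (s, x) (hp x))
    have hx₁ : x₁ ≠ x := by
      intro heq
      have : β • (x₁ - x₂) = 0 := by
        rw [← sub_eq_zero.2 heq, hx]
        obtain rfl : α = 1 - β := by linarith
        module
      rcases smul_eq_zero.1 this with h4 | h4
      · exact hβ.ne' h4
      · exact hne (sub_eq_zero.1 h4)
    have e1 := mul_lt_mul_of_pos_left (hlt x₁ hx₁) hα
    have e2 := mul_le_mul_of_nonneg_left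
      (show η (s, x) + inner ℝ y (x₂ - x) ≤ η (s, x₂) by
        simpa [a] using hsub (s, x) (hp x) (s, x₂) (hp x₂)) hβ.le
    have e3 : α * inner ℝ y (x₁ - x) + β * inner ℝ y (x₂ - x) = 0 := by
      rw [← real_inner_smul_right, ← real_inner_smul_right, ← inner_add_right]
      have : α • (x₁ - x) + β • (x₂ - x) = 0 := by
        rw [hx]
        obtain rfl : α = 1 - β := by linarith
        module
      rw [this, inner_zero_right]
    have e4 : η (s, x) = α * η (s, x) + β * η (s, x) := by rw [← add_mul, hαβ, one_mul]
    simp only [smul_eq_mul]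
    linarith
  · have : (⋃ x, subdifferential (fun x' => η (s, x')) x) = U := by
      ext y
      simp only [mem_iUnion, hpt s hs]
      constructor
      · rintro ⟨x, rfl⟩
        exact hYU _ (mem_slab.2 hs)
      · intro hy
        exact ⟨g y - s • ∇ w y, (hYuniq (s, _) (mem_slab.2 hs) y hy rfl).symm⟩
    rw [this]
    exact hIm
  -- At interior times `η` is differentiable, so each subgradient is `(w (Y p), Y p)`, a point of
  -- the graph of `w`.
  · refine measure_mono_null ?_ (volume_graph_eq_zero h.isOpen h.contDiffOn_velocity.continuousOn)
    refine iUnion₂_subset fun p hp q hq => ?_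
    have hps : p ∈ slab n T := mem_slab.2 (Ioo_subset_Icc_self hp.1)
    have hnhds := slab_mem_nhds hp.1
    have heq : spaceTimeFunctional q.1 q.2 = a p := by
      refine ((hηd p hps).hasFDerivAt hnhds).eq_of_subgradient ?_
      filter_upwards [hnhds] with r hr
      simpa using hq r hr
    have hq2 : q.2 = Y p := by
      refine ext_inner_right ℝ fun v => ?_
      simpa [a] using congrArg (fun l : ℝ × RSpace n →L[ℝ] ℝ => l (0, v)) heq
    have hq1 : q.1 = w (Y p) := by
      simpa [a] using congrArg (fun l : ℝ × RSpace n →L[ℝ] ℝ => l (1, 0)) heq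
    exact ⟨hq2 ▸ hYU p hps, hq2 ▸ hq1⟩

end Existence

/-! ### Every `C¹` solution has an affine dual; regularity. -/

section Uniqueness

theorem add_mul_le_of_forall_Ioo {T α β γ δ : ℝ} (hT : 0 < T)
    (h : ∀ s ∈ Ioo 0 T, α + β * s ≤ γ + δ * s) : ∀ s ∈ Icc 0 T, α + β * s ≤ γ + δ * s := by
  have hcl : IsClosed {s : ℝ | α + β * s ≤ γ + δ * s} :=
    isClosed_le (by fun_prop) (by fun_prop)
  have := closure_minimal (show Ioo 0 T ⊆ _ from h) hcl
  rwa [closure_Ioo hT.ne] at this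

/-- A function on `[0, T]` that has subgradients everywhere, and whose subgradients at interior
points form a null set, is affine. -/
theorem affine_of_volume_subgradients_eq_zero {T c : ℝ} (hT : 0 < T) {h k : ℝ → ℝ}
    (hsub : ∀ s ∈ Icc 0 T, ∃ p : ℝ, ∀ s' ∈ Icc 0 T, h s + p * (s' - s) ≤ h s')
    (hnull : volume {p : ℝ | ∃ s ∈ Ioo 0 T, ∀ s' ∈ Icc 0 T, h s + p * (s' - s) ≤ h s'} = 0)
    (h0 : ∀ s ∈ Icc 0 T, h 0 + c * s ≤ h s) (hk : ∀ s ∈ Icc 0 T, h s ≤ k s) (hk0 : k 0 = h 0)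
    (hkd : HasDerivWithinAt k c (Icc 0 T) 0) : ∀ s ∈ Icc 0 T, h s = h 0 + c * s := by
  have hconv : ConvexOn ℝ (Icc 0 T) h := by
    refine convexOn_of_forall_exists_subgradient (convex_Icc 0 T) fun s hs => ?_
    obtain ⟨p, hp⟩ := hsub s hs
    exact ⟨p • ContinuousLinearMap.id ℝ ℝ, fun s' hs' => by simpa using hp s' hs'⟩
  have hcont : ContinuousOn h (Ioo 0 T) :=
    (hconv.subset Ioo_subset_Icc_self (convex_Ioo 0 T)).continuousOn isOpen_Ioo
  have huniq : ∀ s₁ ∈ Ioo 0 T, ∀ s₂ ∈ Ioo 0 T, ∀ p₁ p₂ : ℝ,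
      (∀ s' ∈ Icc 0 T, h s₁ + p₁ * (s' - s₁) ≤ h s') →
      (∀ s' ∈ Icc 0 T, h s₂ + p₂ * (s' - s₂) ≤ h s') → p₂ ≤ p₁ := by
    intro s₁ hs₁ s₂ hs₂ p₁ p₂ hp₁ hp₂
    by_contra! hlt
    have e1 := hp₁ s₂ (Ioo_subset_Icc_self hs₂)
    have e2 := hp₂ s₁ (Ioo_subset_Icc_self hs₁)
    have hle : s₁ ≤ s₂ := by
      by_contra! hgt
      nlinarith [mul_pos (sub_pos.2 hlt) (sub_pos.2 hgt)]
    have hIcc : Icc s₁ s₂ ⊆ Ioo 0 T := Icc_subset_Ioo hs₁.1 hs₂.2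
    -- For a slope `r` strictly between, a minimiser of `h - r s` on `[s₁, s₂]` is a global one: the
    -- subgradients `p₁` and `p₂` control the two outer pieces.
    have hsubset : Ioo p₁ p₂ ⊆
        {p : ℝ | ∃ s ∈ Ioo 0 T, ∀ s' ∈ Icc 0 T, h s + p * (s' - s) ≤ h s'} := by
      intro r hr
      obtain ⟨m, hm, hmin⟩ := isCompact_Icc.exists_isMinOn (nonempty_Icc.2 hle)
        (f := fun s => h s - r * s) ((hcont.mono hIcc).sub (by fun_prop))
      refine ⟨m, hIcc hm, fun s' hs' => ?_⟩
      have m1 : h m - r * m ≤ h s₁ - r * s₁ := hmin (left_mem_Icc.2 hle)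
      have m2 : h m - r * m ≤ h s₂ - r * s₂ := hmin (right_mem_Icc.2 hle)
      rcases lt_or_ge s' s₁ with h1 | h1
      · have := hp₁ s' hs'
        nlinarith [mul_pos (sub_pos.2 hr.1) (sub_pos.2 h1)]
      rcases lt_or_ge s₂ s' with h2 | h2
      · have := hp₂ s' hs'
        nlinarith [mul_pos (sub_pos.2 hr.2) (sub_pos.2 h2)]
      have : h m - r * m ≤ h s' - r * s' := hmin ⟨h1, h2⟩
      linarith
    have := measure_mono_null hsubset hnull
    rw [Real.volume_Ioo, ENNReal.ofReal_eq_zero] at this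
    linarith
  have hmid : T / 2 ∈ Ioo 0 T := ⟨by linarith, by linarith⟩
  obtain ⟨p, hp⟩ := hsub (T / 2) (Ioo_subset_Icc_self hmid)
  set A := h (T / 2) - p * (T / 2) with hA
  have hpsub : ∀ s ∈ Ioo 0 T, ∀ s' ∈ Icc 0 T, h s + p * (s' - s) ≤ h s' := by
    intro s hs
    obtain ⟨q, hq⟩ := hsub s (Ioo_subset_Icc_self hs)
    have : q = p := le_antisymm (huniq _ hmid _ hs _ _ hp hq) (huniq _ hs _ hmid _ _ hq hp)
    rwa [← this]
  have haff : ∀ s ∈ Ioo 0 T, h s = A + p * s := by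
    intro s hs
    have e1 := hpsub s hs _ (Ioo_subset_Icc_self hmid)
    have e2 := hp s (Ioo_subset_Icc_self hs)
    linarith
  -- Convexity alone allows an upward jump at an endpoint. The subgradient of `h` at `t` excludes
  -- it.
  have hends : ∀ t ∈ Icc 0 T, h t = A + p * t := by
    intro t ht
    have e1 := hpsub _ hmid t ht
    obtain ⟨q, hq⟩ := hsub t ht
    have e2 := add_mul_le_of_forall_Ioo hT (α := h t - q * t) (β := q) (γ := A) (δ := p)
      (fun s hs => by
        have := hq s (Ioo_subset_Icc_self hs)
        rw [haff s hs] at this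
        linarith) t ht
    linarith
  have hz : (0 : ℝ) ∈ Icc 0 T := ⟨le_rfl, hT.le⟩
  have hA0 : h 0 = A := by simpa using hends 0 hz
  have hcp : c ≤ p := by
    have e1 := h0 T ⟨hT.le, le_rfl⟩
    have e2 := hends T ⟨hT.le, le_rfl⟩
    rw [e2, hA0] at e1
    exact le_of_mul_le_mul_right (by linarith) hT
  -- `k` lies above `h` and touches it at `0`, so its right derivative there dominates the slope of
  -- `h`.
  have hpc : p ≤ c := by
    have hkd' : HasDerivWithinAt k c (Ioi 0) 0 :=
      hkd.mono_of_mem_nhdsWithin (Icc_mem_nhdsGT hT)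
    rw [hasDerivWithinAt_iff_tendsto_slope' (by simp)] at hkd'
    refine ge_of_tendsto hkd' ?_
    filter_upwards [Ioo_mem_nhdsGT hT] with s hs
    have e1 := hk s (Ioo_subset_Icc_self hs)
    rw [haff s hs] at e1
    rw [slope_def_field, sub_zero, le_div_iff₀ hs.1, hk0, hA0]
    linarith
  intro s hs
  rw [hends s hs, hA0, le_antisymm hcp hpc]

/-- `A` need not be measurable, so Fubini is applied to its measurable hull. -/
theorem ae_volume_section_eq_zero {n : ℕ} {A : Set (ℝ × RSpace n)} (hA : volume A = 0) :
    ∀ᵐ y : RSpace n, volume ((fun a : ℝ => (a, y)) ⁻¹' A) = 0 := by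
  have hm := measurableSet_toMeasurable volume A
  have h0 : volume (toMeasurable volume A) = 0 := by rw [measure_toMeasurable, hA]
  rw [Measure.volume_eq_prod, Measure.prod_apply_symm (by rwa [← Measure.volume_eq_prod]),
    lintegral_eq_zero_iff (measurable_measure_prodMk_right
      (by rwa [← Measure.volume_eq_prod]))] at h0
  filter_upwards [h0] with y hy
  exact measure_mono_null (preimage_mono (subset_toMeasurable _ _)) hy

variable {n : ℕ} {P : Set (RSpace n)} {ψ₀ ψ₁ : RSpace n → ℝ} {T s : ℝ} {η : ℝ × RSpace n → ℝ}

namespace IsAdmissibleC1Solution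

theorem hasFDerivWithinAt (hη : IsAdmissibleC1Solution ψ₀ ψ₁ P T η) {p : ℝ × RSpace n}
    (hp : p ∈ slab n T) : HasFDerivWithinAt η (fderivWithin ℝ η (slab n T) p) (slab n T) p :=
  (hη.2.differentiableOn (by simp) p hp).hasFDerivWithinAt

theorem hasFDerivAt_slice (hη : IsAdmissibleC1Solution ψ₀ ψ₁ P T η) (hs : s ∈ Icc 0 T)
    (x : RSpace n) : HasFDerivAt (fun x => η (s, x)) ((fderivWithin ℝ η (slab n T) (s, x)).comp
      (ContinuousLinearMap.inr ℝ ℝ (RSpace n))) x := by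
  have h1 : HasFDerivWithinAt (fun x : RSpace n => (s, x))
      (ContinuousLinearMap.inr ℝ ℝ (RSpace n)) univ x :=
    (hasFDerivAt_prodMk_right s x).hasFDerivWithinAt
  rw [← hasFDerivWithinAt_univ]
  exact (hη.hasFDerivWithinAt (mem_slab.2 hs)).comp x h1 (fun z _ => mem_slab.2 hs)

theorem differentiable (hη : IsAdmissibleC1Solution ψ₀ ψ₁ P T η) (hs : s ∈ Icc 0 T) :
    Differentiable ℝ (fun x => η (s, x)) := fun x =>
  (hη.hasFDerivAt_slice hs x).differentiableAt

theorem fderivWithin_apply (hη : IsAdmissibleC1Solution ψ₀ ψ₁ P T η) (hs : s ∈ Icc 0 T)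
    (x : RSpace n) (t : ℝ) (v : RSpace n) : fderivWithin ℝ η (slab n T) (s, x) (t, v)
      = fderivWithin ℝ η (slab n T) (s, x) (1, 0) * t
        + inner ℝ (∇ (fun x => η (s, x)) x) v := by
  have h1 := (hη.differentiable hs x).hasGradientAt.hasFDerivAt.unique (hη.hasFDerivAt_slice hs x)
  have h2 := congrArg (fun l : RSpace n →L[ℝ] ℝ => l v) h1
  simp only [InnerProductSpace.toDual_apply_apply, ContinuousLinearMap.comp_apply,
    ContinuousLinearMap.inr_apply] at h2
  have e : ((t, v) : ℝ × RSpace n) = t • ((1 : ℝ), (0 : RSpace n)) + (0, v) := by simp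
  rw [h2, e, map_add, map_smul, smul_eq_mul, mul_comm]

theorem range_gradient (hη : IsAdmissibleC1Solution ψ₀ ψ₁ P T η) (hs : s ∈ Icc 0 T) :
    range (∇ (fun x => η (s, x))) = interior P := by
  have hd := hη.differentiable hs
  have hc := hη.1.strictConvexOn s hs
  rw [range_gradient_eq_interior hd hc, ← hη.1.closure_image s hs]
  congr 2
  ext y
  simp only [mem_iUnion, mem_range]
  refine exists_congr fun x => ⟨?_, fun hy => ?_⟩
  · rintro rfl x'
    exact (hd x).hasGradientAt.add_inner_le hc.convexOn (mem_univ _) (mem_univ _)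
  · exact ((hd x).hasGradientAt.eq_of_subgradient (Eventually.of_forall hy)).symm

/-- Along a solution the spatial Legendre transform is affine in time. -/
theorem legendreTransform_eq (hη : IsAdmissibleC1Solution ψ₀ ψ₁ P T η) (hT : 0 < T)
    (h : IsDualFamily (range (∇ ψ₀)) (legendreTransform ψ₀)
      (fun y => ψ₁ (Function.invFun (∇ ψ₀) y)) (Function.invFun (∇ ψ₀)))
    (hs : s ∈ Icc 0 T) : EqOn (legendreTransform (fun x => η (s, x)))
      (fun y => legendreTransform ψ₀ y - s * ψ₁ (Function.invFun (∇ ψ₀) y)) (interior P) := by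
  have hz : (0 : ℝ) ∈ Icc 0 T := ⟨le_rfl, hT.le⟩
  have hη0 : (fun x => η (0, x)) = ψ₀ := funext hη.1.initial_value
  have hU0 : range (∇ ψ₀) = interior P := by rw [← hη.range_gradient hz, hη0]
  have hd := fun {s} (hs : s ∈ Icc 0 T) => hη.differentiable hs
  have hc := fun {s} (hs : s ∈ Icc 0 T) => (hη.1.strictConvexOn s hs).convexOn
  let X : ℝ → RSpace n → RSpace n := fun s => Function.invFun (∇ (fun x => η (s, x)))
  -- `H y s` is the minimum over `x` of `η (s, x) - ⟨y, x⟩`, attained at `X s y`.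
  let H : RSpace n → ℝ → ℝ := fun y s => -legendreTransform (fun x => η (s, x)) y
  have hX : ∀ s ∈ Icc 0 T, ∀ y ∈ interior P, ∇ (fun x => η (s, x)) (X s y) = y :=
    fun s hs y hy => gradient_invFun (by rwa [hη.range_gradient hs])
  have hHX : ∀ s ∈ Icc 0 T, ∀ y ∈ interior P,
      H y s = η (s, X s y) - inner ℝ y (X s y) := fun s hs y hy => by
    simp only [H]
    rw [_root_.legendreTransform_eq (hd hs) (hc hs) (by rwa [hη.range_gradient hs]),
      real_inner_comm]
    ring
  have hHle : ∀ s ∈ Icc 0 T, ∀ y ∈ interior P, ∀ x, H y s ≤ η (s, x) - inner ℝ y x :=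
    fun s hs y hy x => by
      have := inner_sub_le_legendreTransform (hd hs) (hc hs)
        (by rwa [hη.range_gradient hs] : y ∈ _) x
      rw [real_inner_comm] at this
      simp only [H]
      linarith
  have hsub : ∀ s ∈ Icc 0 T, ∀ y ∈ interior P, ∀ s' ∈ Icc 0 T,
      H y s + fderivWithin ℝ η (slab n T) (s, X s y) (1, 0) * (s' - s) ≤ H y s' := by
    intro s hs y hy s' hs'
    have h1 := hη.1.convexOn.add_fderivWithin_le (mem_slab.2 hs)
      (show (s', X s' y) ∈ slab n T from mem_slab.2 hs')
      (hη.hasFDerivWithinAt (p := (s, X s y)) (mem_slab.2 hs))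
    rw [Prod.mk_sub_mk, hη.fderivWithin_apply hs, hX s hs y hy, inner_sub_right] at h1
    rw [hHX s hs y hy, hHX s' hs' y hy]
    linarith
  have hvel : ∀ x, fderivWithin ℝ η (slab n T) (0, x) (1, 0) = ψ₁ x := fun x => by
    have h1 : HasDerivWithinAt (fun s : ℝ => (s, x)) ((1 : ℝ), (0 : RSpace n)) (Icc 0 T) 0 :=
      ((hasDerivAt_id (0 : ℝ)).prodMk (hasDerivAt_const 0 x)).hasDerivWithinAt
    have h2 := (hη.hasFDerivWithinAt (p := (0, x)) (mem_slab.2 hz)).comp_hasDerivWithinAt (0 : ℝ)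
      h1 (fun s hs => mem_slab.2 hs)
    exact (uniqueDiffOn_Icc hT 0 hz).eq_deriv _ h2 (hη.1.initial_velocity x)
  have hae : ∀ᵐ y : RSpace n, y ∈ interior P → ∀ s ∈ Icc 0 T,
      H y s = H y 0 + ψ₁ (X 0 y) * s := by
    filter_upwards [ae_volume_section_eq_zero hη.1.alexandrov.volume_image] with y hy hyP
    refine affine_of_volume_subgradients_eq_zero hT
      (k := fun s => η (s, X 0 y) - inner ℝ y (X 0 y))
      (fun s hs => ⟨_, hsub s hs y hyP⟩) (measure_mono_null ?_ hy) (fun s hs => ?_)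
      (fun s hs => hHle s hs y hyP _) (hHX 0 hz y hyP).symm
      ((hη.1.initial_velocity _).sub_const _)
    -- A time subgradient `p` of `H y` lifts to the space-time subgradient `(p, y)` of `η` at `(s, X
    -- s y)`, so it belongs to a null section.
    · rintro p ⟨s, hs, hp⟩
      have hs' := Ioo_subset_Icc_self hs
      refine mem_iUnion₂.2 ⟨(s, X s y), ⟨hs, mem_univ _⟩, fun q hq => ?_⟩
      have h1 := (hp q.1 (mem_slab.1 hq)).trans (hHle q.1 (mem_slab.1 hq) y hyP q.2)
      rw [hHX s hs' y hyP] at h1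
      simp only [inner_sub_right]
      linarith
    · have := hsub 0 hz y hyP s hs
      rwa [hvel, sub_zero] at this
  have hconvU : Convex ℝ (interior P) := hU0 ▸ h.convex
  -- Both sides are continuous on the open set, so almost everywhere improves to everywhere.
  refine Measure.eqOn_open_of_ae_eq (μ := volume) ?_ isOpen_interior ?_ ?_
  · refine (ae_restrict_iff' isOpen_interior.measurableSet).2 ?_
    filter_upwards [hae] with y hy hyP
    have := hy hyP s hs
    simp only [H, X, hη0] at this
    linarith
  · have := convexOn_legendreTransform (hd hs) (hc hs) (by rwa [hη.range_gradient hs])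
    rw [hη.range_gradient hs] at this
    exact this.continuousOn isOpen_interior
  · rw [← hU0]
    exact h.contDiffOn_potential.continuousOn.sub
      (h.contDiffOn_velocity.continuousOn.const_smul s)

/-- `u - T w` is the Legendre transform of the terminal slice. -/
theorem convexOn_potential (hη : IsAdmissibleC1Solution ψ₀ ψ₁ P T η) (hT : 0 < T)
    (h : IsDualFamily (range (∇ ψ₀)) (legendreTransform ψ₀)
      (fun y => ψ₁ (Function.invFun (∇ ψ₀) y)) (Function.invFun (∇ ψ₀))) :
    ConvexOn ℝ (range (∇ ψ₀))
      (fun y => legendreTransform ψ₀ y - T * ψ₁ (Function.invFun (∇ ψ₀) y)) := by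
  have hTm : T ∈ Icc 0 T := ⟨hT.le, le_rfl⟩
  have hz : (0 : ℝ) ∈ Icc 0 T := ⟨le_rfl, hT.le⟩
  have hU0 : range (∇ ψ₀) = interior P := by
    rw [← hη.range_gradient hz, show (fun x => η (0, x)) = ψ₀ from funext hη.1.initial_value]
  have hUT := hη.range_gradient hTm
  have hconv := h.convex
  rw [hU0] at hconv ⊢
  have := convexOn_legendreTransform (hη.differentiable hTm) (hη.1.strictConvexOn T hTm).convexOn
    (hUT ▸ hconv)
  rw [hUT] at this
  exact this.congr (hη.legendreTransform_eq hT h hTm)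

/-- Affinity in time makes the spatial gradient of `η` the inverse of `g - s ∇w`, which is smooth
for `s < S`; `η` is then the explicit conjugate. -/
theorem contDiffOn (hη : IsAdmissibleC1Solution ψ₀ ψ₁ P T η) (hT : 0 < T)
    (h : IsDualFamily (range (∇ ψ₀)) (legendreTransform ψ₀)
      (fun y => ψ₁ (Function.invFun (∇ ψ₀) y)) (Function.invFun (∇ ψ₀)))
    {S : ℝ} (hS : 0 < S) (hconv : ConvexOn ℝ (range (∇ ψ₀))
      (fun y => legendreTransform ψ₀ y - S * ψ₁ (Function.invFun (∇ ψ₀) y)))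
    {I : Set ℝ} (hIT : I ⊆ Icc 0 T) (hIS : I ⊆ Ico 0 S) : ContDiffOn ℝ ∞ η (I ×ˢ univ) := by
  have hz : (0 : ℝ) ∈ Icc 0 T := ⟨le_rfl, hT.le⟩
  have hU0 : range (∇ ψ₀) = interior P := by
    rw [← hη.range_gradient hz, show (fun x => η (0, x)) = ψ₀ from funext hη.1.initial_value]
  let Y : ℝ × RSpace n → RSpace n := fun p => ∇ (fun x => η (p.1, x)) p.2
  have hYU : ∀ s ∈ I, ∀ x, Y (s, x) ∈ range (∇ ψ₀) := fun s hs x => by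
    rw [hU0, ← hη.range_gradient (hIT hs)]
    exact ⟨x, rfl⟩
  have hval : ∀ s ∈ I, ∀ x, η (s, x) = inner ℝ x (Y (s, x)) - (legendreTransform ψ₀ (Y (s, x))
      - s * ψ₁ (Function.invFun (∇ ψ₀) (Y (s, x)))) := fun s hs x => by
    have h1 := legendreTransform_gradient (hη.differentiable (hIT hs))
      (hη.1.strictConvexOn s (hIT hs)).convexOn x
    have h2 := hη.legendreTransform_eq hT h (hIT hs) (hU0 ▸ hYU s hs x)
    dsimp only [Y] at h2 ⊢
    linarith
  have hY : ContDiffOn ℝ ∞ Y (I ×ˢ univ) := by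
    refine h.contDiffOn_inverse hS hconv hIS fun s hs x => ⟨hYU s hs x, ?_⟩
    refine h.gradient_eq_of_isMaxOn (hYU s hs x) fun y' hy' => ?_
    have h1 := inner_sub_le_legendreTransform (hη.differentiable (hIT hs))
      (hη.1.strictConvexOn s (hIT hs)).convexOn
      (by rwa [hη.range_gradient (hIT hs), ← hU0] : y' ∈ _) x
    have h2 := hη.legendreTransform_eq hT h (hIT hs) (hU0 ▸ hy')
    have h3 := hval s hs x
    dsimp only at h2 ⊢
    linarith
  exact (h.contDiffOn_conjugate hY fun p hp => hYU p.1 hp.1 p.2).congr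
    fun p hp => hval p.1 hp.1 p.2

end IsAdmissibleC1Solution

end Uniqueness

theorem theorem1p12 (n : ℕ) (P : Set (RSpace n))
    (hP : ∃ V : Set (RSpace n), V.Finite ∧ P = convexHull ℝ V)
    (ψ₀ ψ₁ : RSpace n → ℝ)
    (hψ₀ : ContDiff ℝ ∞ ψ₀)
    (hHess : ∀ x v : RSpace n, v ≠ 0 → 0 < fderiv ℝ (fderiv ℝ ψ₀) x v v)
    (hIm : closure (range (∇ ψ₀)) = P)
    (hψ₁ : ContDiff ℝ ∞ ψ₁)
    (hbdd : ∃ C : ℝ, ∀ x, |ψ₁ x| ≤ C) :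
    (∀ (T : ℝ) (η : ℝ × RSpace n → ℝ), 0 < T → IsAdmissibleC1Solution ψ₀ ψ₁ P T η →
      ContDiffOn ℝ ∞ η (Ico 0 T ×ˢ univ) ∧
      (ENNReal.ofReal T < cvxLifespan ψ₀ ψ₁ → ContDiffOn ℝ ∞ η (slab n T))) ∧
    c1Lifespan ψ₀ ψ₁ P = cvxLifespan ψ₀ ψ₁ ∧
    (∀ T : ℝ, 0 < T → cvxLifespan ψ₀ ψ₁ < ENNReal.ofReal T →
      ¬ ∃ η : ℝ × RSpace n → ℝ, IsAdmissibleC1Solution ψ₀ ψ₁ P T η) := by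
  obtain ⟨V, hV, hPV⟩ := hP
  have hPc : IsCompact P := hPV ▸ hV.isCompact_convexHull (𝕜 := ℝ)
  have hPconv : Convex ℝ P := hPV ▸ convex_convexHull ℝ V
  have h := isDualFamily_legendreTransform hPc hPconv hψ₀ hHess hIm hψ₁
  have hle : ∀ (T : ℝ) (η : ℝ × RSpace n → ℝ), 0 < T → IsAdmissibleC1Solution ψ₀ ψ₁ P T η →
      ENNReal.ofReal T ≤ cvxLifespan ψ₀ ψ₁ := fun T η hT hη =>
    le_iSup₂_of_le T ⟨hT, hη.convexOn_potential hT h⟩ le_rfl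
  refine ⟨fun T η hT hη => ⟨?_, fun hlt => ?_⟩, le_antisymm ?_ ?_, ?_⟩
  -- The solution itself supplies convexity at `S = T`, which suffices on the half-open interval.
  · exact hη.contDiffOn hT h hT (hη.convexOn_potential hT h) Ico_subset_Icc_self Subset.rfl
  · rw [cvxLifespan, lt_iSup_iff] at hlt
    obtain ⟨S, hlt⟩ := hlt
    obtain ⟨⟨hS, hconv⟩, hlt⟩ := lt_iSup_iff.1 hlt
    have hTS := (ENNReal.ofReal_lt_ofReal_iff hS).1 hlt
    exact hη.contDiffOn hT h hS hconv Subset.rfl fun s hs => ⟨hs.1, hs.2.trans_lt hTS⟩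
  · exact iSup₂_le fun T ⟨hT, η, hη⟩ => hle T η hT hη
  · refine iSup₂_le fun S ⟨hS, hconv⟩ => le_of_forall_lt fun c hc => ?_
    -- Existence needs `T < S` strictly; the supremum is unaffected.
    obtain ⟨T, hcT, hTS⟩ := exists_between hc
    have hTtop : T ≠ ⊤ := (hTS.trans ENNReal.ofReal_lt_top).ne
    have hT0 : 0 < T.toReal := ENNReal.toReal_pos (bot_le.trans_lt hcT).ne' hTtop
    have hTS' : T.toReal < S := by
      rw [← ENNReal.ofReal_toReal hTtop] at hTS
      exact (ENNReal.ofReal_lt_ofReal_iff hS).1 hTS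
    refine hcT.trans_le (le_iSup₂_of_le T.toReal ⟨hT0, ?_⟩ (ENNReal.ofReal_toReal hTtop).ge)
    exact exists_isAdmissibleC1Solution hPc hPconv hψ₀ hHess hIm hψ₁ hT0 hTS' hconv
  · rintro T hT hlt ⟨η, hη⟩
    exact absurd (hle T η hT hη) (not_le.2 hlt)
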